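/- Let $\Omega=(a,b)$ with $-\infty<a<b<\infty$ and write $|\Omega|=b-a$. Equip $H_0^1(\Omega)$ (the closure of $C_c^\infty(\Omega)$ in $H^1(\Omega)$) with the norm $\|v\|_{H_0^1(\Omega)}=\|v'\|_{L^2(\Omega)}$ and let $Y_2=\{v\in H_0^1(\Omega): v''\in L^2(\Omega)\}$ with $\|v\|_{Y_2}=\|v\|_{H_0^1(\Omega)}+\|v''\|_{L^2(\Omega)}$. Denote by $B_R$ the closed ball of radius $R$ around $0$ in $H_0^1(\Omega)$ and by $\mathrm{Lip}(g,[\alpha,\beta])$ the smallest Lipschitz constant of $g$ on $[\alpha,\beta]$. A map $F\colon X\to Y$ between normed spaces is called Newton differentiable with derivative $G_F\colon X\to\mathcal L(X,Y)$ if $\|F(x+h)-F(x)-G_F(x+h)h\|_Y/\|h\|_X\to0$ as $0<\|h\|_X\to0$, for every $x\in X$. Let $\varphi\in C^2([a,b])$ with $\varphi(a)=\varphi(b)=0$, let $k>0$, let $\psi\in L^\infty(\Omega)$ with $\psi\ge0$ a.e., and let $g\colon\mathbb R\to\mathbb R$ be locally Lipschitz continuous, nonincreasing, and Newton differentiable with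 a Borel-measurable derivative $G_g\colon\mathbb R\to\mathbb R$ satisfying $G_g(s)\in\partial_c g(s)$ (Clarke's generalized differential) for all $s\in\mathbb R$. Then, for every $u\in H_0^1(\Omega)$, the problem $$kT-T''=g(\psi T-u)\ \text{ in }\Omega,\qquad \partial_\nu T=0\ \text{ on }\partial\Omega \tag{1}$$ has a unique weak solution $T\in H^1(\Omega)$, and $\varphi T\in Y_2$. For $R>0$ set $N_R:=|\Omega|^{1/2}R/2$ and $$M_R:=N_R+\|\psi\|_{L^\infty(\Omega)}\big(|\Omega|^{-1/2}k^{-1}+|\Omega|^{1/2}k^{-1/2}\big)\Big(\mathrm{Lip}(g,[-N_R,N_R])\frac{2N_R}{\pi}+|g(0)|\Big)|\Omega|^{1/2}.$$ The operator $\Phi\colon H_0^1(\Omega)\to Y_2$, $\Phi(u):=\varphi T$ with $T$ the solution of (1), has the following properties. (i) For all $R>0$ and $u_1,u_2\in B_R$, $$\|\Phi(u_1)-\Phi(u_2)\|_{H_0^1(\Omega)}\le \mathrm{Lip}(g,[-M_R,M_R])\big(\|\varphi\|_{L^\infty(\Omega)}k^{-1/2}+\|\varphi'\|_{L^\infty(\Omega)}k^{-1}\big)\frac{|\Omega|}{\pi}\|u_1-u_2\|_{H_0^1(\Omega)}.$$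 (ii) For every $R>0$ there is $C_R>0$ such that $\|\Phi(u_1)-\Phi(u_2)\|_{Y_2}\le C_R\|u_1-u_2\|_{H_0^1(\Omega)}$ for all $u_1,u_2\in B_R$. (iii) For $u,h\in H_0^1(\Omega)$ and $T$ the solution of (1), the linear problem $$k\xi_h-\xi_h''-G_g(\psi T-u)\psi\,\xi_h=-G_g(\psi T-u)h\ \text{ in }\Omega,\qquad \partial_\nu\xi_h=0\ \text{ on }\partial\Omega$$ has a unique weak solution $\xi_h\in H^1(\Omega)$, and $G_\Phi(u)h:=\varphi\xi_h$ defines a map $G_\Phi\colon H_0^1(\Omega)\to\mathcal L(H_0^1(\Omega),Y_2)$. The map $\Phi\colon H_0^1(\Omega)\to Y_2$ is Newton differentiable with derivative $G_\Phi$. Moreover, for every $R>0$ the limit below exists and, for all $u\in B_R$, $$\|G_\Phi(u)\|_{\mathcal L(H_0^1(\Omega),H_0^1(\Omega))}\le \lim_{t\searrow M_R}\mathrm{Lip}(g,[-t,t])\big(\|\varphi\|_{L^\infty(\Omega)}k^{-1/2}+\|\varphi'\|_{L^\infty(\Omega)}k^{-1}\big)\frac{|\Omega|}{\pi}.$$ 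-/

import Mathlib

open MeasureTheory Filter Topology Set
open scoped ENNReal ContDiff

noncomputable section

namespace NeumannObstacle

/-! ### Generalized differentiation -/

/-- Newton differentiability of `F : X → Y` on all of `X` with Newton derivative `G`. -/
def IsNewtonDifferentiable {X Y : Type*} [NormedAddCommGroup X] [NormedSpace ℝ X]
    [NormedAddCommGroup Y] [NormedSpace ℝ Y] (F : X → Y) (G : X → X →L[ℝ] Y) : Prop :=
  ∀ x : X, Tendsto (fun h : X => ‖F (x + h) - F x - G (x + h) h‖ / ‖h‖) (𝓝[≠] 0) (𝓝 0)

/-- Clarke's generalized directional derivative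
`g°(x; v) = limsup_{y → x, t ↘ 0} (g (y + t v) - g y) / t` (of a locally Lipschitz `g`). -/
def clarkeDirDeriv (g : ℝ → ℝ) (x v : ℝ) : ℝ :=
  limsup (fun p : ℝ × ℝ => (g (p.1 + p.2 * v) - g p.1) / p.2) (𝓝 x ×ˢ 𝓝[>] (0 : ℝ))

/-- Clarke's generalized differential of a locally Lipschitz `g : ℝ → ℝ`. -/
def clarkeDifferential (g : ℝ → ℝ) (x : ℝ) : Set ℝ :=
  {ζ | ∀ v : ℝ, ζ * v ≤ clarkeDirDeriv g x v}

/-- The smallest Lipschitz constant of `g` on `[α, β]`. -/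
def lipOn (g : ℝ → ℝ) (α β : ℝ) : ℝ :=
  sInf {c : ℝ | 0 ≤ c ∧ ∀ s ∈ Icc α β, ∀ t ∈ Icc α β, |g s - g t| ≤ c * |s - t|}

/-! ### Sobolev spaces on the interval `Ω = (a, b)` -/

/-- Lebesgue measure on `Ω = (a, b)`. -/
abbrev dom (a b : ℝ) : Measure ℝ := volume.restrict (Ioo a b)

/-- `L²(Ω)`. -/
abbrev L2 (a b : ℝ) : Type := Lp ℝ 2 (dom a b)

/-- The norm of `L^∞(Ω)` (of an essentially bounded function). -/
def supNorm (a b : ℝ) (f : ℝ → ℝ) : ℝ := (eLpNorm f ∞ (dom a b)).toReal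

/-- `η ∈ C_c^∞(Ω)`. -/
structure IsTest (a b : ℝ) (η : ℝ → ℝ) : Prop where
  smooth : ContDiff ℝ ∞ η
  compact : HasCompactSupport η
  supp : tsupport η ⊆ Ioo a b

/-- `w` is the weak derivative of `v` on `Ω`. -/
def HasWeakDeriv (a b : ℝ) (v w : L2 a b) : Prop :=
  ∀ η : ℝ → ℝ, IsTest a b η → ∫ x, v x * deriv η x ∂(dom a b) = -∫ x, w x * η x ∂(dom a b)

theorem integrable_mul_of_compact {a b : ℝ} (v : L2 a b) {f : ℝ → ℝ} (hf : Continuous f)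
    (hc : HasCompactSupport f) : Integrable (fun x => v x * f x) (dom a b) :=
  (Lp.memLp v).integrable_mul (q := 2) (hf.memLp_of_hasCompactSupport hc)

theorem IsTest.integrable_mul {a b : ℝ} {η : ℝ → ℝ} (h : IsTest a b η) (v : L2 a b) :
    Integrable (fun x => v x * η x) (dom a b) :=
  integrable_mul_of_compact v h.smooth.continuous h.compact

theorem IsTest.integrable_mul_deriv {a b : ℝ} {η : ℝ → ℝ} (h : IsTest a b η) (v : L2 a b) :
    Integrable (fun x => v x * deriv η x) (dom a b) :=
  integrable_mul_of_compact v (h.smooth.continuous_deriv (by simp)) h.compact.deriv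

theorem HasWeakDeriv.add {a b : ℝ} {v w v' w' : L2 a b} (h : HasWeakDeriv a b v w)
    (h' : HasWeakDeriv a b v' w') : HasWeakDeriv a b (v + v') (w + w') := by
  intro η hη
  have e1 : ∫ x, (v + v') x * deriv η x ∂(dom a b)
      = ∫ x, v x * deriv η x + v' x * deriv η x ∂(dom a b) := by
    refine integral_congr_ae ?_
    filter_upwards [Lp.coeFn_add v v'] with x hx
    rw [hx, Pi.add_apply, add_mul]
  have e2 : ∫ x, (w + w') x * η x ∂(dom a b)
      = ∫ x, w x * η x + w' x * η x ∂(dom a b) := by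
    refine integral_congr_ae ?_
    filter_upwards [Lp.coeFn_add w w'] with x hx
    rw [hx, Pi.add_apply, add_mul]
  rw [e1, e2, integral_add (hη.integrable_mul_deriv v) (hη.integrable_mul_deriv v'),
    integral_add (hη.integrable_mul w) (hη.integrable_mul w'), h η hη, h' η hη]
  ring

theorem HasWeakDeriv.smul {a b : ℝ} (c : ℝ) {v w : L2 a b} (h : HasWeakDeriv a b v w) :
    HasWeakDeriv a b (c • v) (c • w) := by
  intro η hη
  have e1 : ∫ x, (c • v) x * deriv η x ∂(dom a b)
      = ∫ x, c * (v x * deriv η x) ∂(dom a b) := by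
    refine integral_congr_ae ?_
    filter_upwards [Lp.coeFn_smul c v] with x hx
    rw [hx, Pi.smul_apply, smul_eq_mul, mul_assoc]
  have e2 : ∫ x, (c • w) x * η x ∂(dom a b)
      = ∫ x, c * (w x * η x) ∂(dom a b) := by
    refine integral_congr_ae ?_
    filter_upwards [Lp.coeFn_smul c w] with x hx
    rw [hx, Pi.smul_apply, smul_eq_mul, mul_assoc]
  rw [e1, e2, integral_const_mul, integral_const_mul, h η hη]
  ring

theorem HasWeakDeriv.zero (a b : ℝ) : HasWeakDeriv a b 0 0 := by
  intro η _
  have e : ∀ f : ℝ → ℝ, ∫ x, (0 : L2 a b) x * f x ∂(dom a b) = 0 := by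
    intro f
    refine integral_eq_zero_of_ae ?_
    filter_upwards [Lp.coeFn_zero ℝ 2 (dom a b)] with x hx
    rw [hx]
    simp
  rw [e, e, neg_zero]

/-- `H¹(Ω)`: the pairs `(v, v')` of an `L²`-function and its `L²` weak derivative, with the
norm `(‖v‖² + ‖v'‖²)^(1/2)`. -/
def H1 (a b : ℝ) : Submodule ℝ (WithLp 2 (L2 a b × L2 a b)) where
  carrier := {p | HasWeakDeriv a b p.fst p.snd}
  add_mem' h h' := HasWeakDeriv.add h h'
  zero_mem' := HasWeakDeriv.zero a b
  smul_mem' c _ h := HasWeakDeriv.smul c h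

/-- The `L²`-function underlying an element of `H¹(Ω)`. -/
def H1.fn {a b : ℝ} : H1 a b →L[ℝ] L2 a b :=
  (WithLp.fstL 2 ℝ (L2 a b) (L2 a b)).comp (H1 a b).subtypeL

/-- The weak derivative of an element of `H¹(Ω)`. -/
def H1.wd {a b : ℝ} : H1 a b →L[ℝ] L2 a b :=
  (WithLp.sndL 2 ℝ (L2 a b) (L2 a b)).comp (H1 a b).subtypeL

/-- `C_c^∞(Ω)` as a subspace of `H¹(Ω)`. -/
def testSpace (a b : ℝ) : Submodule ℝ (H1 a b) where
  carrier := {v | ∃ η, IsTest a b η ∧ H1.fn v =ᵐ[dom a b] η ∧ H1.wd v =ᵐ[dom a b] deriv η}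
  add_mem' := by
    rintro v v' ⟨η, hη, h1, h2⟩ ⟨η', hη', h1', h2'⟩
    refine ⟨η + η', ⟨hη.smooth.add hη'.smooth, hη.compact.add hη'.compact,
      (tsupport_add η η').trans (union_subset hη.supp hη'.supp)⟩, ?_, ?_⟩
    · rw [map_add]
      filter_upwards [Lp.coeFn_add (H1.fn v) (H1.fn v'), h1, h1'] with x e e1 e2
      rw [e, Pi.add_apply, e1, e2, Pi.add_apply]
    · rw [map_add]
      filter_upwards [Lp.coeFn_add (H1.wd v) (H1.wd v'), h2, h2'] with x e e1 e2
      rw [e, Pi.add_apply, e1, e2, deriv_add (hη.smooth.differentiable (by simp) x)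
        (hη'.smooth.differentiable (by simp) x)]
  zero_mem' := by
    refine ⟨0, ⟨contDiff_const, HasCompactSupport.zero, by simp⟩, ?_, ?_⟩
    · rw [map_zero]
      exact Lp.coeFn_zero ℝ 2 _
    · rw [map_zero]
      filter_upwards [Lp.coeFn_zero ℝ 2 (dom a b)] with x e
      rw [e]
      simp
  smul_mem' := by
    rintro c v ⟨η, hη, h1, h2⟩
    refine ⟨c • η, ⟨contDiff_const.smul hη.smooth, hη.compact.smul_left,
      (tsupport_smul_subset_right (fun _ => c) η).trans hη.supp⟩, ?_, ?_⟩
    · rw [map_smul]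
      filter_upwards [Lp.coeFn_smul c (H1.fn v), h1] with x e e1
      rw [e, Pi.smul_apply, e1, Pi.smul_apply]
    · rw [map_smul]
      filter_upwards [Lp.coeFn_smul c (H1.wd v), h2] with x e e1
      rw [e, Pi.smul_apply, e1, deriv_const_smul _ (hη.smooth.differentiable (by simp) x)]

/-- The closure of `C_c^∞(Ω)` in `H¹(Ω)`. -/
def H10Sub (a b : ℝ) : Submodule ℝ (H1 a b) := (testSpace a b).topologicalClosure

theorem memLp_of_continuous {a b : ℝ} {f : ℝ → ℝ} (hf : Continuous f) :
    MemLp f 2 (dom a b) := by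
  obtain ⟨C, hC⟩ := (isCompact_Icc (a := a) (b := b)).exists_bound_of_continuousOn hf.continuousOn
  refine MemLp.of_bound hf.aestronglyMeasurable C ?_
  filter_upwards [ae_restrict_mem measurableSet_Ioo] with x hx
  exact hC x (Ioo_subset_Icc_self hx)

theorem H10Sub.integral_by_parts {a b : ℝ} {v : H1 a b} (hv : v ∈ H10Sub a b) {f f' : ℝ → ℝ}
    (hf : ∀ x, HasDerivAt f (f' x) x) (hf' : Continuous f') :
    ∫ x, f' x * H1.fn v x ∂(dom a b) + ∫ x, f x * H1.wd v x ∂(dom a b) = 0 := by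
  have hfc : Continuous f := continuous_iff_continuousAt.2 fun x => (hf x).continuousAt
  have key : ∀ {q : ℝ → ℝ} (hq : Continuous q) (w : L2 a b),
      ∫ x, q x * w x ∂(dom a b) = inner ℝ ((memLp_of_continuous (a := a) (b := b) hq).toLp q) w := by
    intro q hq w
    rw [L2.inner_def]
    refine integral_congr_ae ?_
    filter_upwards [(memLp_of_continuous (a := a) (b := b) hq).coeFn_toLp] with x hx
    rw [hx]
    simp [mul_comm]
  have hcl : IsClosed {v : H1 a b |
      ∫ x, f' x * H1.fn v x ∂(dom a b) + ∫ x, f x * H1.wd v x ∂(dom a b) = 0} := by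
    simp only [key hf', key hfc]
    exact isClosed_eq (by fun_prop) continuous_const
  refine closure_minimal ?_ hcl hv
  rintro w ⟨η, hη, h1, h2⟩
  have hηd : ∀ x, HasDerivAt η (deriv η x) x :=
    fun x => (hη.smooth.differentiable (by simp) x).hasDerivAt
  have hηc : Continuous (deriv η) := hη.smooth.continuous_deriv (by simp)
  have e1 : ∫ x, f' x * H1.fn w x ∂(dom a b) = ∫ x, f' x * η x := by
    rw [integral_congr_ae (g := fun x => f' x * η x)
      (by filter_upwards [h1] with x hx; rw [hx])]
    refine setIntegral_eq_integral_of_forall_compl_eq_zero fun x hx => ?_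
    rw [image_eq_zero_of_notMem_tsupport fun h => hx (hη.supp h), mul_zero]
  have e2 : ∫ x, f x * H1.wd w x ∂(dom a b) = ∫ x, f x * deriv η x := by
    rw [integral_congr_ae (g := fun x => f x * deriv η x)
      (by filter_upwards [h2] with x hx; rw [hx])]
    refine setIntegral_eq_integral_of_forall_compl_eq_zero fun x hx => ?_
    rw [image_eq_zero_of_notMem_tsupport
      fun h => hx (hη.supp ((tsupport_deriv_subset (𝕜 := ℝ)) h)), mul_zero]
  simp only [mem_ofPred_eq]
  rw [e1, e2, integral_mul_deriv_eq_deriv_mul_of_integrable (fun x _ => hf x) (fun x _ => hηd x)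
    ((hfc.mul hηc).integrable_of_hasCompactSupport hη.compact.deriv.mul_left)
    ((hf'.mul hη.smooth.continuous).integrable_of_hasCompactSupport hη.compact.mul_left)
    ((hfc.mul hη.smooth.continuous).integrable_of_hasCompactSupport hη.compact.mul_left)]
  ring

theorem H10Sub.eq_zero_of_wd {a b : ℝ} {v : H1 a b} (hv : v ∈ H10Sub a b)
    (h0 : H1.wd v = 0) : v = 0 := by
  have hfn : H1.fn v = 0 := by
    refine Lp.ext ?_
    have h := isOpen_Ioo.ae_eq_zero_of_integral_contDiff_smul_eq_zero (U := Ioo a b)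
      (μ := dom a b) (f := H1.fn v)
      (((Lp.memLp (H1.fn v)).integrable (by norm_num)).locallyIntegrable.locallyIntegrableOn _)
      (by
        intro q hq _ _
        have h := H10Sub.integral_by_parts hv (f := fun x => ∫ t in (0 : ℝ)..x, q t) (f' := q)
          (fun x => hq.continuous.integral_hasStrictDerivAt 0 x |>.hasDerivAt) hq.continuous
        have e : ∫ x, (∫ t in (0 : ℝ)..x, q t) * H1.wd v x ∂(dom a b) = 0 := by
          refine integral_eq_zero_of_ae ?_
          filter_upwards [Lp.coeFn_zero ℝ 2 (dom a b)] with x hx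
          rw [h0, hx]
          simp
        rw [e, add_zero] at h
        simpa using h)
    filter_upwards [h, ae_restrict_mem measurableSet_Ioo, Lp.coeFn_zero ℝ 2 (dom a b)]
      with x hx hm hz
    rw [hx hm, hz]
    rfl
  refine Subtype.ext ?_
  exact (WithLp.ofLp_injective 2) (Prod.ext hfn h0)

/-- `H₀¹(Ω)`, a type of its own because its norm is `‖v'‖_{L²(Ω)}`. -/
def H10 (a b : ℝ) : Type := ↥(H10Sub a b)

namespace H10

variable {a b : ℝ}

instance : AddCommGroup (H10 a b) := inferInstanceAs (AddCommGroup ↥(H10Sub a b))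

instance : Module ℝ (H10 a b) := inferInstanceAs (Module ℝ ↥(H10Sub a b))

/-- The inclusion of `H₀¹(Ω)` into `H¹(Ω)`. -/
def toH1 : H10 a b →ₗ[ℝ] H1 a b := (H10Sub a b).subtype

/-- The weak derivative on `H₀¹(Ω)`. -/
def wd : H10 a b →ₗ[ℝ] L2 a b := (H1.wd : H1 a b →L[ℝ] L2 a b).toLinearMap ∘ₗ toH1

theorem wd_injective : Function.Injective (wd : H10 a b →ₗ[ℝ] L2 a b) := by
  refine (injective_iff_map_eq_zero _).2 fun v hv => ?_
  exact Subtype.ext (H10Sub.eq_zero_of_wd (Subtype.property (p := (· ∈ H10Sub a b)) v) hv)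

instance : NormedAddCommGroup (H10 a b) :=
  NormedAddCommGroup.induced (H10 a b) (L2 a b) wd wd_injective

instance : NormedSpace ℝ (H10 a b) := NormedSpace.induced ℝ (H10 a b) (L2 a b) wd

theorem norm_eq (v : H10 a b) : ‖v‖ = ‖wd v‖ := rfl

/-- The `L²`-function underlying an element of `H₀¹(Ω)`. -/
def fn (v : H10 a b) : L2 a b := H1.fn (toH1 v)

end H10

/-- `Y₂ = {v ∈ H₀¹(Ω) | Δv ∈ L²(Ω)}`: the pairs `(v, Δv)`, with the norm
`‖v‖_{H₀¹(Ω)} + ‖Δv‖_{L²(Ω)}`. -/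
def Y2 (a b : ℝ) : Submodule ℝ (WithLp 1 (H10 a b × L2 a b)) where
  carrier := {p | HasWeakDeriv a b (H10.wd p.fst) p.snd}
  add_mem' {p q} h h' := by
    have : H10.wd (p + q).fst = H10.wd p.fst + H10.wd q.fst := map_add H10.wd p.fst q.fst
    simp only [mem_ofPred_eq, this]
    exact HasWeakDeriv.add h h'
  zero_mem' := by
    have : H10.wd (0 : WithLp 1 (H10 a b × L2 a b)).fst = 0 := map_zero H10.wd
    simp only [mem_ofPred_eq, this]
    exact HasWeakDeriv.zero a b
  smul_mem' c p h := by
    have : H10.wd (c • p).fst = c • H10.wd p.fst := map_smul H10.wd c p.fst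
    simp only [mem_ofPred_eq, this]
    exact HasWeakDeriv.smul c h

namespace Y2

variable {a b : ℝ}

/-- The embedding of `Y₂` into `H₀¹(Ω)`. -/
def toH10 : Y2 a b →L[ℝ] H10 a b :=
  (WithLp.fstL 1 ℝ (H10 a b) (L2 a b)).comp (Y2 a b).subtypeL

/-- The Laplacian (second derivative) of an element of `Y₂`. -/
def lap : Y2 a b →L[ℝ] L2 a b :=
  (WithLp.sndL 1 ℝ (H10 a b) (L2 a b)).comp (Y2 a b).subtypeL

theorem norm_eq (y : Y2 a b) : ‖y‖ = ‖toH10 y‖ + ‖lap y‖ := by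
  have h := WithLp.prod_norm_eq_of_nat (p := 1) 1 (by simp) (y : WithLp 1 (H10 a b × L2 a b))
  simp only [Nat.cast_one, pow_one, Real.rpow_one, div_one] at h
  exact h

/-- `y` is (represented by) the function `f`. -/
def IsFn (y : Y2 a b) (f : ℝ → ℝ) : Prop := H10.fn (toH10 y) =ᵐ[dom a b] f

end Y2

/-! ### The Neumann problem and its linearization -/

/-- `v ∈ H¹(Ω)` is the weak solution of `k v - v'' = F` in `Ω`, `∂_ν v = 0` on `∂Ω`,
where `F ∈ L²(Ω)`. -/
def SolvesNeumann {a b : ℝ} (k : ℝ) (F : ℝ → ℝ) (v : H1 a b) : Prop :=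
  MemLp F 2 (dom a b) ∧ ∀ w : H1 a b,
    ∫ x, (k * (H1.fn v x * H1.fn w x) + H1.wd v x * H1.wd w x) ∂(dom a b)
      = ∫ x, F x * H1.fn w x ∂(dom a b)

/-- `T` is a weak solution of `k T - T'' = g(ψ T - u)`, `∂_ν T = 0`. -/
def IsState {a b : ℝ} (k : ℝ) (ψ g : ℝ → ℝ) (u : H10 a b) (T : H1 a b) : Prop :=
  SolvesNeumann k (fun x => g (ψ x * H1.fn T x - H10.fn u x)) T

/-- `ξ` is a weak solution of
`k ξ - ξ'' - G(ψ T - u) ψ ξ = - G(ψ T - u) h`, `∂_ν ξ = 0`. -/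
def IsLinearizedState {a b : ℝ} (k : ℝ) (ψ G : ℝ → ℝ) (u : H10 a b) (T : H1 a b)
    (h : H10 a b) (ξ : H1 a b) : Prop :=
  SolvesNeumann k (fun x => G (ψ x * H1.fn T x - H10.fn u x) * ψ x * H1.fn ξ x
    - G (ψ x * H1.fn T x - H10.fn u x) * H10.fn h x) ξ

/-! ### Constants; here `|Ω| = diam Ω = b - a` -/

/-- `N_R`. -/
def boundN (a b R : ℝ) : ℝ := (b - a) ^ (1 / 2 : ℝ) * R / 2

/-- `M_R`. -/
def boundM (a b k : ℝ) (ψ g : ℝ → ℝ) (R : ℝ) : ℝ :=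
  boundN a b R + supNorm a b ψ
    * ((b - a) ^ (-(1 / 2) : ℝ) * k⁻¹ + (b - a) ^ (1 / 2 : ℝ) * k ^ (-(1 / 2) : ℝ))
    * ((lipOn g (-boundN a b R) (boundN a b R) * (2 * boundN a b R / Real.pi) + |g 0|)
      * (b - a) ^ (1 / 2 : ℝ))

/-- `(‖φ‖_{L^∞} k^{-1/2} + ‖φ'‖_{L^∞} k^{-1}) |Ω| / π`. -/
def factor (a b k : ℝ) (φ : ℝ → ℝ) : ℝ :=
  (supNorm a b φ * k ^ (-(1 / 2) : ℝ) + supNorm a b (deriv φ) * k⁻¹) * ((b - a) / Real.pi)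

end NeumannObstacle

end

open MeasureTheory Filter Topology NeumannObstacle

open MeasureTheory Filter Topology Set
open scoped ENNReal ContDiff

noncomputable section

namespace NeumannObstacle

/-! Everything rests on one energy estimate. Testing `k v - v'' = f` with `v` gives `k‖v‖² + ‖v'‖² =
∫ f v`, and here `f` may be replaced by any `ρ` with `(f - ρ) v ≤ 0` almost everywhere
(`IsVarSol.energy`). Hence `‖v‖ ≤ k⁻¹‖ρ‖` and `‖v'‖ ≤ k^(-1/2)‖ρ‖`. As `g` is nonincreasing and `ψ ≥
0`, the dependence of the right-hand side on the state has the favourable sign and can always be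
dropped in this way. The choice `ρ = 0` gives uniqueness; `ρ = g(-u)` gives the a priori bound
`M_R`; `ρ = g(ψT' - u) - g(ψT' - u')` gives the Lipschitz estimates; `ρ = -G_g(ψT - u) h` bounds the
linearized solution.

The explicit constants come from the embedding of `H¹` into `L^∞` (`H1.ae_abs_le`), from the bound
of an `H₀¹` function by half of its total variation (`H10Sub.ae_abs_le`) and from the Poincaré
inequality with constant `|Ω|/π` (`H10Sub.poincare`). All of them use that functions with a weak
derivative have absolutely continuous representatives.

Existence for globally Lipschitz `g` is Zarantonello's theorem
(`exists_eq_zero_of_strongly_monotone`). For locally Lipschitz `g` the argument is clipped to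
`[-M_R, M_R]` with `R = ‖u‖`; the a priori bound shows that the solution does not notice the
clipping. The product `φT` lies in `Y₂` because `T'' = kT - f` is in `L²` and `φ` vanishes at the
end points.

For Newton differentiability, `r = T(u+h) - T(u) - ξ_h` solves the linearized equation at `u + h`,
with the pointwise Newton remainder of `g` as source, so `norm_weighted_remainder_le` reduces the
claim to the `L²` norm of that remainder. By stability and the `L^∞` embeddings the argument of `g`
moves by `O(‖h‖)` uniformly in `x`. The remainder divided by `‖h‖` is thus bounded and tends to zero
pointwise, and dominated convergence applies (`tendsto_norm_remainder`). -/

/-! ### Absolutely continuous primitives -/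

/-- `V` is absolutely continuous on `[a, b]` with almost everywhere derivative `w`. -/
structure IsPrimitive (a b : ℝ) (V w : ℝ → ℝ) : Prop where
  ac : AbsolutelyContinuousOnInterval V a b
  deriv_ae : deriv V =ᵐ[dom a b] w

theorem integral_dom {a b : ℝ} (hab : a ≤ b) (f : ℝ → ℝ) :
    ∫ x, f x ∂(dom a b) = ∫ x in a..b, f x := by
  rw [intervalIntegral.integral_of_le hab, integral_Ioc_eq_integral_Ioo]

theorem intervalIntegrable_of_dom {a b : ℝ} (hab : a ≤ b) {f : ℝ → ℝ}
    (hf : Integrable f (dom a b)) : IntervalIntegrable f volume a b :=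
  (intervalIntegrable_iff_integrableOn_Ioo_of_le hab).2 hf

theorem integrable_dom_of_continuousOn {a b : ℝ} {f : ℝ → ℝ} (hf : ContinuousOn f (Icc a b)) :
    Integrable f (dom a b) :=
  (hf.integrableOn_Icc).mono_set Ioo_subset_Icc_self

namespace IsPrimitive

variable {a b : ℝ} {V w U z : ℝ → ℝ}

theorem of_contDiff (hV : ContDiff ℝ 1 V) : IsPrimitive a b V (deriv V) :=
  ⟨hV.contDiffOn.absolutelyContinuousOnInterval, ae_eq_refl _⟩

theorem congr_deriv (h : IsPrimitive a b V w) (hz : w =ᵐ[dom a b] z) : IsPrimitive a b V z :=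
  ⟨h.ac, h.deriv_ae.trans hz⟩

theorem continuousOn (hab : a ≤ b) (h : IsPrimitive a b V w) : ContinuousOn V (Icc a b) := by
  simpa [uIcc_of_le hab] using h.ac.continuousOn

theorem ae_differentiableAt (hab : a ≤ b) (h : IsPrimitive a b V w) :
    ∀ᵐ x ∂(dom a b), HasDerivAt V (w x) x := by
  filter_upwards [ae_restrict_of_ae h.ac.ae_differentiableAt, h.deriv_ae,
    ae_restrict_mem measurableSet_Ioo] with x h1 h2 h3
  rw [uIcc_of_le hab] at h1
  rw [← h2]
  exact (h1 (Ioo_subset_Icc_self h3)).hasDerivAt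

theorem mul (hab : a ≤ b) (h : IsPrimitive a b V w) (h' : IsPrimitive a b U z) :
    IsPrimitive a b (fun x => V x * U x) (fun x => w x * U x + V x * z x) := by
  refine ⟨h.ac.fun_mul h'.ac, ?_⟩
  filter_upwards [h.ae_differentiableAt hab, h'.ae_differentiableAt hab] with x h1 h2
  exact (h1.mul h2).deriv

theorem add (hab : a ≤ b) (h : IsPrimitive a b V w) (h' : IsPrimitive a b U z) :
    IsPrimitive a b (fun x => V x + U x) (fun x => w x + z x) := by
  refine ⟨h.ac.fun_add h'.ac, ?_⟩
  filter_upwards [h.ae_differentiableAt hab, h'.ae_differentiableAt hab] with x h1 h2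
  exact (h1.add h2).deriv

theorem integral_eq (hab : a ≤ b) (h : IsPrimitive a b V w) {x y : ℝ} (hx : x ∈ Icc a b)
    (hy : y ∈ Icc a b) (hxy : x ≤ y) : ∫ t in x..y, w t = V y - V x := by
  have hs : uIcc x y ⊆ uIcc a b := by
    rw [uIcc_of_le hab, uIcc_of_le hxy]; exact Icc_subset_Icc hx.1 hy.2
  rw [← (h.ac.mono hs).integral_deriv_eq_sub, intervalIntegral.integral_of_le hxy,
    intervalIntegral.integral_of_le hxy, integral_Ioc_eq_integral_Ioo, integral_Ioc_eq_integral_Ioo]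
  exact integral_congr_ae (ae_mono (Measure.restrict_mono (Ioo_subset_Ioo hx.1 hy.2) le_rfl)
    h.deriv_ae.symm)

theorem integral_dom_eq (hab : a ≤ b) (h : IsPrimitive a b V w) :
    ∫ x, w x ∂(dom a b) = V b - V a := by
  rw [integral_dom hab, h.integral_eq hab (left_mem_Icc.2 hab) (right_mem_Icc.2 hab) hab]

theorem of_integrable (hab : a ≤ b) (hw : Integrable w (dom a b)) (c : ℝ) :
    IsPrimitive a b (fun x => c + ∫ t in a..x, w t) w := by
  have hi := intervalIntegrable_of_dom hab hw
  have h1 : IsPrimitive a b (fun x => ∫ t in a..x, w t) w := by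
    refine ⟨hi.absolutelyContinuousOnInterval_intervalIntegral (by simp), ?_⟩
    filter_upwards [ae_restrict_of_ae hi.ae_hasDerivAt_integral,
      ae_restrict_mem measurableSet_Ioo] with x hx h3
    rw [uIcc_of_le hab] at hx
    exact (hx (Ioo_subset_Icc_self h3) a (left_mem_Icc.2 hab)).deriv
  have h2 : IsPrimitive a b (fun _ => c) (fun _ => 0) := by
    simpa using of_contDiff (a := a) (b := b) (V := fun _ => c) contDiff_const
  simpa using h2.add hab h1

end IsPrimitive

/-! ### Weak derivatives and absolutely continuous representatives -/

/-- For a test function `η` the product `V η` is absolutely continuous and vanishes at both end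
points, so its derivative integrates to zero. -/
theorem hasWeakDeriv_of_isPrimitive {a b : ℝ} (hab : a ≤ b) {v w : L2 a b} {V : ℝ → ℝ}
    (hv : v =ᵐ[dom a b] V) (h : IsPrimitive a b V w) : HasWeakDeriv a b v w := by
  intro η hη
  have h1 := (h.mul hab (.of_contDiff (hη.smooth.of_le (by simp)))).integral_dom_eq hab
  have ha : η a = 0 := image_eq_zero_of_notMem_tsupport fun h => by simpa using (hη.supp h).1
  have hb : η b = 0 := image_eq_zero_of_notMem_tsupport fun h => by simpa using (hη.supp h).2
  have e : ∀ᵐ x ∂(dom a b), w x * η x + V x * deriv η x = w x * η x + v x * deriv η x := by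
    filter_upwards [hv] with x hx
    rw [hx]
  rw [ha, hb, integral_congr_ae e, integral_add (hη.integrable_mul w)
    (hη.integrable_mul_deriv v)] at h1
  linarith

theorem exists_isTest_integral_eq_one {a b : ℝ} (hab : a < b) :
    ∃ θ : ℝ → ℝ, IsTest a b θ ∧ ∫ x, θ x = 1 := by
  let f : ContDiffBump ((a + b) / 2) := ⟨(b - a) / 8, (b - a) / 4, by linarith, by linarith⟩
  refine ⟨f.normed volume, ⟨f.contDiff_normed, f.hasCompactSupport_normed, ?_⟩, f.integral_normed⟩
  rw [f.tsupport_normed_eq, Real.closedBall_eq_Icc]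
  intro x hx
  have h1 : f.rOut = (b - a) / 4 := rfl
  rw [h1] at hx
  constructor <;> linarith [hx.1, hx.2]

theorem IsTest.integral_dom {a b : ℝ} {η : ℝ → ℝ} (h : IsTest a b η) :
    ∫ x, η x ∂(dom a b) = ∫ x, η x :=
  setIntegral_eq_integral_of_forall_compl_eq_zero fun _ hx =>
    image_eq_zero_of_notMem_tsupport fun hmem => hx (h.supp hmem)

/-- A test function of mean zero is the derivative of a test function. -/
theorem IsTest.exists_primitive {a b : ℝ} (hab : a < b) {q : ℝ → ℝ} (hq : IsTest a b q)
    (h0 : ∫ x, q x = 0) : ∃ η, IsTest a b η ∧ deriv η = q := by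
  have hqc := hq.smooth.continuous
  have hd : ∀ x, HasDerivAt (fun x => ∫ t in a..x, q t) (q x) x := fun x =>
    (hqc.integral_hasStrictDerivAt a x).hasDerivAt
  have hde : deriv (fun x => ∫ t in a..x, q t) = q := funext fun x => (hd x).deriv
  -- The support of `q` lies in some `[c, d]` strictly inside `(a, b)`. The primitive vanishes left
  -- of `c` because `q` does, and right of `d` because `q` has mean zero. If the support is empty,
  -- any degenerate interval serves.
  obtain ⟨c, d, hcd⟩ : ∃ c d : ℝ, a < c ∧ c ≤ d ∧ d < b ∧ tsupport q ⊆ Icc c d := by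
    by_cases hne : (tsupport q).Nonempty
    · have hc : IsCompact (tsupport q) := hq.compact
      refine ⟨sInf (tsupport q), sSup (tsupport q), (hq.supp (hc.sInf_mem hne)).1, ?_,
        (hq.supp (hc.sSup_mem hne)).2, fun x hx => ⟨csInf_le hc.bddBelow hx, le_csSup hc.bddAbove hx⟩⟩
      exact (csInf_le hc.bddBelow (hc.sSup_mem hne))
    · rw [not_nonempty_iff_eq_empty] at hne
      exact ⟨(a + b) / 2, (a + b) / 2, by linarith, le_rfl, by linarith, by simp [hne]⟩
  obtain ⟨hac, hcd', hdb, hs⟩ := hcd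
  have hz : ∀ x, x ∉ Icc c d → q x = 0 := fun x hx =>
    image_eq_zero_of_notMem_tsupport fun h => hx (hs h)
  have hsupp : Function.support (fun x => ∫ t in a..x, q t) ⊆ Icc c d := by
    intro x hx
    by_contra hn
    apply hx
    rw [mem_Icc, not_and_or, not_le, not_le] at hn
    rcases hn with hn | hn
    · refine intervalIntegral.integral_zero_ae (Eventually.of_forall fun t ht => hz t fun h => ?_)
      rcases le_total a x with h' | h'
      · rw [uIoc_of_le h'] at ht; linarith [ht.2, h.1]
      · rw [uIoc_of_ge h'] at ht; linarith [ht.2, h.1]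
    · show ∫ t in a..x, q t = 0
      rw [intervalIntegral.integral_of_le (by linarith), ← h0]
      refine setIntegral_eq_integral_of_forall_compl_eq_zero fun t ht => hz t fun h => ht ?_
      exact ⟨by linarith [h.1], by linarith [h.2]⟩
  have hts : tsupport (fun x => ∫ t in a..x, q t) ⊆ Icc c d :=
    closure_minimal hsupp isClosed_Icc
  refine ⟨fun x => ∫ t in a..x, q t, ⟨?_, ?_, ?_⟩, hde⟩
  · rw [contDiff_infty_iff_deriv, hde]
    exact ⟨fun x => (hd x).differentiableAt, hq.smooth⟩
  · exact isCompact_Icc.of_isClosed_subset (isClosed_tsupport _) hts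
  · exact hts.trans (Icc_subset_Ioo hac hdb)

/-- The lemma of du Bois-Reymond. -/
theorem ae_const_of_integral_mul_deriv_eq_zero {a b : ℝ} (hab : a < b) {f : ℝ → ℝ}
    (hf : Integrable f (dom a b))
    (h : ∀ η, IsTest a b η → ∫ x, f x * deriv η x ∂(dom a b) = 0) :
    ∃ c, f =ᵐ[dom a b] fun _ => c := by
  obtain ⟨θ, hθ, hθ1⟩ := exists_isTest_integral_eq_one hab
  have hint : ∀ {q : ℝ → ℝ}, Continuous q → ∀ {f : ℝ → ℝ}, Integrable f (dom a b) →
      Integrable (fun x => f x * q x) (dom a b) := fun {q} hq f hf => by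
    obtain ⟨C, hC⟩ := (isCompact_Icc (a := a) (b := b)).exists_bound_of_continuousOn hq.continuousOn
    refine hf.mul_bdd (c := C) hq.aestronglyMeasurable ?_
    filter_upwards [ae_restrict_mem measurableSet_Ioo] with x hx
    exact hC x (Ioo_subset_Icc_self hx)
  set c := ∫ x, f x * θ x ∂(dom a b) with hc
  refine ⟨c, ?_⟩
  have hic : Integrable (fun x => f x - c) (dom a b) := hf.sub (integrable_const c)
  have hz := isOpen_Ioo.ae_eq_zero_of_integral_contDiff_smul_eq_zero (U := Ioo a b)
    (μ := dom a b) (f := fun x => f x - c) (hic.locallyIntegrable.locallyIntegrableOn _) (by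
      intro q hq hqc hqs
      have hqT : IsTest a b q := ⟨hq, hqc, hqs⟩
      -- Subtracting a multiple of `θ` makes the mean zero, so that the difference is the derivative
      -- of a test function. The hypothesis then says that `f` and the constant `∫ f θ` have the
      -- same pairing with `q`.
      have hT : IsTest a b (fun x => q x - (∫ y, q y) * θ x) :=
        ⟨hq.sub (contDiff_const.mul hθ.smooth), hqc.sub hθ.compact.mul_left,
          (tsupport_sub _ _).trans (union_subset hqs
            ((tsupport_mul_subset_right (f := fun _ => ∫ y, q y)).trans hθ.supp))⟩
      have hi : ∫ x, q x - (∫ y, q y) * θ x = 0 := by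
        rw [integral_sub (hq.continuous.integrable_of_hasCompactSupport hqc)
          ((hθ.smooth.continuous.integrable_of_hasCompactSupport hθ.compact).const_mul _),
          integral_const_mul, hθ1]
        ring
      obtain ⟨η, hη, hηq⟩ := hT.exists_primitive hab hi
      have h1 := h η hη
      rw [hηq] at h1
      have e : ∀ x, f x * (q x - (∫ y, q y) * θ x) = f x * q x - (∫ y, q y) * (f x * θ x) :=
        fun x => by ring
      simp only [e] at h1
      rw [integral_sub (hint hq.continuous hf) ((hint hθ.smooth.continuous hf).const_mul _),
        integral_const_mul, ← hc] at h1
      have e2 : ∀ x, q x • (f x - c) = f x * q x - c * q x := fun x => by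
        rw [smul_eq_mul]; ring
      simp only [e2]
      rw [integral_sub (hint hq.continuous hf) (((hq.continuous.integrable_of_hasCompactSupport
        hqc).mono_measure Measure.restrict_le_self).const_mul _), integral_const_mul,
        hqT.integral_dom]
      linarith)
  filter_upwards [hz, ae_restrict_mem measurableSet_Ioo] with x hx hm
  linarith [hx hm]

theorem L2.integrable {a b : ℝ} (v : L2 a b) : Integrable v (dom a b) :=
  (Lp.memLp v).integrable (by norm_num)

/-- The difference of `v` and the primitive of `w` has weak derivative zero, hence is constant by du
Bois-Reymond; the constant is absorbed into the primitive. -/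
theorem HasWeakDeriv.exists_isPrimitive {a b : ℝ} (hab : a < b) {v w : L2 a b}
    (h : HasWeakDeriv a b v w) : ∃ V, v =ᵐ[dom a b] V ∧ IsPrimitive a b V w := by
  have hP := IsPrimitive.of_integrable hab.le (L2.integrable w) 0
  have hPc := hP.continuousOn hab.le
  obtain ⟨c, hc⟩ := ae_const_of_integral_mul_deriv_eq_zero hab
    (f := fun x => v x - (0 + ∫ t in a..x, w t))
    ((L2.integrable v).sub (integrable_dom_of_continuousOn hPc)) (by
      intro η hη
      have hw : MemLp (fun x => 0 + ∫ t in a..x, w t) 2 (dom a b) := by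
        obtain ⟨C, hC⟩ := isCompact_Icc.exists_bound_of_continuousOn hPc
        refine MemLp.of_bound (integrable_dom_of_continuousOn hPc).aestronglyMeasurable C ?_
        filter_upwards [ae_restrict_mem measurableSet_Ioo] with x hx
        exact hC x (Ioo_subset_Icc_self hx)
      have h1 := h η hη
      have h2 := hasWeakDeriv_of_isPrimitive hab.le hw.coeFn_toLp hP η hη
      have e : ∀ᵐ x ∂(dom a b), (v x - (0 + ∫ t in a..x, w t)) * deriv η x
          = v x * deriv η x - hw.toLp _ x * deriv η x := by
        filter_upwards [hw.coeFn_toLp] with x hx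
        rw [hx]; ring
      rw [integral_congr_ae e, integral_sub (hη.integrable_mul_deriv _) (hη.integrable_mul_deriv _),
        h1, h2, sub_self])
  refine ⟨_, ?_, IsPrimitive.of_integrable hab.le (L2.integrable w) c⟩
  filter_upwards [hc] with x hx
  linarith

/-! ### The Hilbert space `H¹(Ω)` -/

theorem L2.inner_eq {a b : ℝ} (v w : L2 a b) : inner ℝ v w = ∫ x, v x * w x ∂(dom a b) := by
  rw [MeasureTheory.L2.inner_def]
  refine integral_congr_ae (Eventually.of_forall fun x => ?_)
  simp [mul_comm]

theorem L2.integrable_mul {a b : ℝ} (v w : L2 a b) :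
    Integrable (fun x => v x * w x) (dom a b) :=
  (Lp.memLp v).integrable_mul (q := 2) (Lp.memLp w)

theorem L2.norm_sq_eq {a b : ℝ} (v : L2 a b) : ‖v‖ ^ 2 = ∫ x, v x ^ 2 ∂(dom a b) := by
  rw [← real_inner_self_eq_norm_sq, L2.inner_eq]
  simp only [sq]

theorem L2.norm_le_of_ae_le {a b : ℝ} {v w : L2 a b} {c : ℝ}
    (h : ∀ᵐ x ∂(dom a b), |v x| ≤ c * |w x|) : ‖v‖ ≤ c * ‖w‖ :=
  Lp.norm_le_mul_norm_of_ae_le_mul (by simpa using h)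

/-- Hölder's inequality between `L¹` and `L²` on a set of measure `b - a`. -/
theorem L2.integral_abs_le {a b : ℝ} (hab : a ≤ b) (v : L2 a b) :
    ∫ x, |v x| ∂(dom a b) ≤ √(b - a) * ‖v‖ := by
  have h := (eLpNorm_le_eLpNorm_mul_rpow_measure_univ (p := 1) (q := 2) (by norm_num)
    (Lp.aestronglyMeasurable v) : eLpNorm v 1 (dom a b) ≤ _)
  have h2 : ∫ x, |v x| ∂(dom a b) = (eLpNorm v 1 (dom a b)).toReal := by
    rw [eLpNorm_one_eq_lintegral_enorm, ← integral_norm_eq_lintegral_enorm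
      (Lp.aestronglyMeasurable v)]
    rfl
  rw [h2, Lp.norm_def]
  refine (ENNReal.toReal_mono (ENNReal.mul_ne_top (Lp.eLpNorm_ne_top v)
    (ENNReal.rpow_ne_top_of_nonneg (by norm_num) (measure_ne_top _ _))) h).trans ?_
  rw [ENNReal.toReal_mul, mul_comm]
  refine mul_le_mul_of_nonneg_right (le_of_eq ?_) ENNReal.toReal_nonneg
  rw [← ENNReal.toReal_rpow, Measure.restrict_apply_univ, Real.volume_Ioo,
    ENNReal.toReal_ofReal (by linarith), Real.sqrt_eq_rpow]
  norm_num

namespace H1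

variable {a b : ℝ}

theorem hasWeakDeriv (v : H1 a b) : HasWeakDeriv a b (fn v) (wd v) := v.2

/-- The element of `H¹(Ω)` with given function and weak derivative. -/
def mk {v w : L2 a b} (h : HasWeakDeriv a b v w) : H1 a b := ⟨WithLp.toLp 2 (v, w), h⟩

@[simp] theorem fn_mk {v w : L2 a b} (h : HasWeakDeriv a b v w) : fn (mk h) = v := rfl

@[simp] theorem wd_mk {v w : L2 a b} (h : HasWeakDeriv a b v w) : wd (mk h) = w := rfl

theorem ext' {v w : H1 a b} (h : fn v = fn w) (h' : wd v = wd w) : v = w :=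
  Subtype.ext (WithLp.ofLp_injective 2 (Prod.ext h h'))

theorem inner_eq (v w : H1 a b) :
    inner ℝ v w = inner ℝ (fn v) (fn w) + inner ℝ (wd v) (wd w) := rfl

theorem norm_sq (v : H1 a b) : ‖v‖ ^ 2 = ‖fn v‖ ^ 2 + ‖wd v‖ ^ 2 := by
  simp only [← real_inner_self_eq_norm_sq, inner_eq]

/-- Pairing with fixed elements of `L²` is continuous, so this form exhibits `H¹` as an intersection
of closed sets, which yields its completeness. -/
theorem _root_.NeumannObstacle.hasWeakDeriv_iff_inner {v w : L2 a b} :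
    HasWeakDeriv a b v w ↔ ∀ (η : ℝ → ℝ) (h : IsTest a b η),
      inner ℝ v ((memLp_of_continuous (a := a) (b := b)
        (h.smooth.continuous_deriv (by simp))).toLp (deriv η))
      + inner ℝ w ((memLp_of_continuous (a := a) (b := b) h.smooth.continuous).toLp η) = 0 := by
  have key : ∀ {q : ℝ → ℝ} (hq : Continuous q) (w : L2 a b),
      inner ℝ w ((memLp_of_continuous (a := a) (b := b) hq).toLp q)
        = ∫ x, w x * q x ∂(dom a b) := by
    intro q hq w
    rw [L2.inner_eq]
    refine integral_congr_ae ?_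
    filter_upwards [(memLp_of_continuous (a := a) (b := b) hq).coeFn_toLp] with x hx
    rw [hx]
  refine forall₂_congr fun η h => ?_
  rw [key h.smooth.continuous, key (h.smooth.continuous_deriv (by simp)), eq_neg_iff_add_eq_zero]

theorem isClosed_carrier : IsClosed (H1 a b : Set (WithLp 2 (L2 a b × L2 a b))) := by
  have : (H1 a b : Set (WithLp 2 (L2 a b × L2 a b))) = ⋂ (η : ℝ → ℝ) (h : IsTest a b η),
      {p | inner ℝ p.fst ((memLp_of_continuous (a := a) (b := b)
        (h.smooth.continuous_deriv (by simp))).toLp (deriv η))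
      + inner ℝ p.snd ((memLp_of_continuous (a := a) (b := b) h.smooth.continuous).toLp η) = 0} := by
    ext p
    simp only [mem_iInter]
    exact hasWeakDeriv_iff_inner
  rw [this]
  refine isClosed_iInter fun η => isClosed_iInter fun h => isClosed_eq ?_ continuous_const
  fun_prop

instance : CompleteSpace (H1 a b) :=
  (isClosed_carrier (a := a) (b := b)).isComplete.completeSpace_coe

theorem exists_isPrimitive (hab : a < b) (v : H1 a b) :
    ∃ V, fn v =ᵐ[dom a b] V ∧ IsPrimitive a b V (wd v) :=
  (hasWeakDeriv v).exists_isPrimitive hab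

/-- Test functions as elements of `H¹(Ω)`. -/
theorem _root_.NeumannObstacle.IsTest.exists_H1 {η : ℝ → ℝ} (hη : IsTest a b η) (hab : a ≤ b) :
    ∃ v ∈ testSpace a b, fn v =ᵐ[dom a b] η ∧ wd v =ᵐ[dom a b] deriv η := by
  have h1 := memLp_of_continuous (a := a) (b := b) hη.smooth.continuous
  have h2 := memLp_of_continuous (a := a) (b := b) (hη.smooth.continuous_deriv (by simp))
  have h : HasWeakDeriv a b (h1.toLp η) (h2.toLp (deriv η)) :=
    hasWeakDeriv_of_isPrimitive hab h1.coeFn_toLp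
      ((IsPrimitive.of_contDiff (hη.smooth.of_le (by simp))).congr_deriv h2.coeFn_toLp.symm)
  exact ⟨mk h, ⟨η, hη, h1.coeFn_toLp, h2.coeFn_toLp⟩, h1.coeFn_toLp, h2.coeFn_toLp⟩

/-- Elements of `H₀¹(Ω)` vanish at the end points. -/
theorem eq_zero_of_mem_H10Sub (hab : a < b) {v : H1 a b} (hv : v ∈ H10Sub a b) {V : ℝ → ℝ}
    (hV : fn v =ᵐ[dom a b] V) (h : IsPrimitive a b V (wd v)) : V a = 0 ∧ V b = 0 := by
  -- The weight `1` gives `V b = V a`; the weight `x - a` gives `(b - a) V b = 0`.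
  have h1 := H10Sub.integral_by_parts hv (f := fun _ => 1) (f' := fun _ => 0)
    (fun x => hasDerivAt_const x 1) continuous_const
  have h2 := H10Sub.integral_by_parts hv (f := fun x => x - a) (f' := fun _ => 1)
    (fun x => (hasDerivAt_id x).sub_const a) continuous_const
  have e1 := h.integral_dom_eq hab.le
  have e2 := ((IsPrimitive.of_contDiff (V := fun x => x - a) (by fun_prop)).mul hab.le
    h).integral_dom_eq hab.le
  have e3 : ∀ᵐ x ∂(dom a b), deriv (fun x => x - a) x * V x + (x - a) * wd v x
      = 1 * fn v x + (x - a) * wd v x := by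
    filter_upwards [hV] with x hx
    rw [hx]; simp
  rw [integral_congr_ae e3, integral_add, h2] at e2
  · simp only [zero_mul, integral_zero, one_mul, zero_add, e1] at h1
    rw [sub_self, zero_mul, sub_zero] at e2
    have : V b = 0 := by
      rcases mul_eq_zero.1 e2.symm with h | h
      · linarith
      · exact h
    exact ⟨by linarith, this⟩
  · simpa using L2.integrable _
  · obtain ⟨C, hC⟩ := (isCompact_Icc (a := a) (b := b)).exists_bound_of_continuousOn
      (f := fun x => x - a) (by fun_prop)
    refine (L2.integrable _).bdd_mul (c := C) (by fun_prop) ?_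
    filter_upwards [ae_restrict_mem measurableSet_Ioo] with x hx
    exact hC x (Ioo_subset_Icc_self hx)

/-- A function of `H¹(Ω)` that vanishes at the end points belongs to `H₀¹(Ω)`. -/
theorem mem_H10Sub_of_eq_zero (hab : a < b) {v : H1 a b} {V : ℝ → ℝ}
    (hV : fn v =ᵐ[dom a b] V) (h : IsPrimitive a b V (wd v)) (ha : V a = 0) (hb : V b = 0) :
    v ∈ H10Sub a b := by
  -- The closure is the double orthogonal complement. An element `z` orthogonal to all test
  -- functions satisfies `z'' = z` weakly, so the `H¹` inner product of `v` and `z` is `∫ (V z')'`,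
  -- a boundary term that vanishes with `V`.
  rw [H10Sub, ← Submodule.orthogonal_orthogonal_eq_closure, Submodule.mem_orthogonal']
  intro z hz
  have hw : HasWeakDeriv a b (wd z) (fn z) := by
    intro η hη
    obtain ⟨y, hy, h1, h2⟩ := hη.exists_H1 hab.le
    have h3 := (Submodule.mem_orthogonal' _ _).1 hz y hy
    rw [inner_eq, L2.inner_eq, L2.inner_eq] at h3
    rw [integral_congr_ae (f := fun x => fn z x * fn y x) (g := fun x => fn z x * η x)
      (by filter_upwards [h1] with x hx; rw [hx]),
      integral_congr_ae (f := fun x => wd z x * wd y x) (g := fun x => wd z x * deriv η x)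
      (by filter_upwards [h2] with x hx; rw [hx])] at h3
    linarith
  obtain ⟨Z, hZ, hZP⟩ := hw.exists_isPrimitive hab
  have e := (h.mul hab.le hZP).integral_dom_eq hab.le
  rw [ha, hb, integral_congr_ae (g := fun x => wd v x * wd z x + fn v x * fn z x)
    (by filter_upwards [hZ, hV] with x hx hx'; rw [hx, hx'])] at e
  rw [integral_add (L2.integrable_mul _ _) (L2.integrable_mul _ _)] at e
  rw [inner_eq, L2.inner_eq, L2.inner_eq]
  linarith

/-- The embedding of `H¹(Ω)` into `L^∞(Ω)`. -/
theorem ae_abs_le (hab : a < b) (v : H1 a b) :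
    ∀ᵐ x ∂(dom a b), |fn v x| ≤
      (b - a) ^ (-(1 / 2) : ℝ) * ‖fn v‖ + (b - a) ^ (1 / 2 : ℝ) * ‖wd v‖ := by
  obtain ⟨V, hV, hP⟩ := H1.exists_isPrimitive hab v
  have hpos : 0 < b - a := sub_pos.2 hab
  have hw : Integrable (fun x => |wd v x|) (dom a b) := (L2.integrable _).abs
  have key : ∀ x ∈ Ioo a b, ∀ y ∈ Ioo a b, x ≤ y → |V y - V x| ≤ √(b - a) * ‖wd v‖ := by
    intro x hx y hy hxy
    rw [← hP.integral_eq hab.le (Ioo_subset_Icc_self hx) (Ioo_subset_Icc_self hy) hxy]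
    refine (intervalIntegral.abs_integral_le_integral_abs hxy).trans
      (le_trans ?_ (L2.integral_abs_le hab.le (wd v)))
    rw [intervalIntegral.integral_of_le hxy, integral_Ioc_eq_integral_Ioo]
    exact setIntegral_mono_set hw (Eventually.of_forall fun x => abs_nonneg _)
      (Ioo_subset_Ioo hx.1.le hy.2.le).eventuallyLE
  have key' : ∀ x ∈ Ioo a b, ∀ y ∈ Ioo a b, |V x| ≤ |V y| + √(b - a) * ‖wd v‖ := by
    intro x hx y hy
    have h1 := abs_sub_abs_le_abs_sub (V x) (V y)
    rcases le_total x y with h | h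
    · have h2 := key x hx y hy h
      rw [abs_sub_comm] at h2
      linarith
    · linarith [key y hy x hx h]
  have hVi : ∫ x, |V x| ∂(dom a b) ≤ √(b - a) * ‖fn v‖ := by
    refine le_trans (le_of_eq (integral_congr_ae ?_)) (L2.integral_abs_le hab.le (fn v))
    filter_upwards [hV] with x hx
    rw [hx]
  have hVint : Integrable V (dom a b) := integrable_dom_of_continuousOn (hP.continuousOn hab.le)
  filter_upwards [hV, ae_restrict_mem measurableSet_Ioo] with x hx hxm
  -- Averaging `|V x| ≤ |V y| + osc` over `y` replaces the unknown value `V y` by the mean of `|V|`.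
  have h1 : ∫ y, |V x| ∂(dom a b) ≤ ∫ y, (|V y| + √(b - a) * ‖wd v‖) ∂(dom a b) := by
    refine integral_mono_ae (integrable_const _) (hVint.abs.add (integrable_const _)) ?_
    filter_upwards [ae_restrict_mem measurableSet_Ioo] with y hy
    exact key' x hxm y hy
  rw [integral_add hVint.abs (integrable_const _)] at h1
  simp only [integral_const, smul_eq_mul, measureReal_restrict_apply_univ, Real.volume_real_Ioo_of_le
    hab.le] at h1
  have hs : 0 < √(b - a) := Real.sqrt_pos.2 hpos
  have hss : √(b - a) * √(b - a) = b - a := Real.mul_self_sqrt hpos.le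
  rw [hx, Real.rpow_neg hpos.le, ← Real.sqrt_eq_rpow]
  have h2 : (b - a) * |V x| ≤ √(b - a) * ‖fn v‖ + (b - a) * (√(b - a) * ‖wd v‖) := by linarith
  have h3 : (√(b - a))⁻¹ * ‖fn v‖ + √(b - a) * ‖wd v‖
      = (b - a)⁻¹ * (√(b - a) * ‖fn v‖ + (b - a) * (√(b - a) * ‖wd v‖)) := by
    rw [mul_add, ← mul_assoc, ← mul_assoc, inv_mul_cancel₀ hpos.ne', one_mul]
    congr 2
    rw [inv_eq_iff_eq_inv, mul_inv, inv_inv, eq_mul_inv_iff_mul_eq₀ hs.ne', hss]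
  rw [h3, inv_mul_eq_div, le_div_iff₀ hpos]
  linarith

end H1

/-! ### Pointwise and Poincaré inequalities in `H₀¹(Ω)` -/

/-- Half of the total variation bounds the functions of `H₀¹(Ω)`. -/
theorem H10Sub.ae_abs_le {a b : ℝ} (hab : a < b) {v : H1 a b} (hv : v ∈ H10Sub a b) :
    ∀ᵐ x ∂(dom a b), |H1.fn v x| ≤ (b - a) ^ (1 / 2 : ℝ) * ‖H1.wd v‖ / 2 := by
  obtain ⟨V, hV, hP⟩ := H1.exists_isPrimitive hab v
  obtain ⟨ha, hb⟩ := H1.eq_zero_of_mem_H10Sub hab hv hV hP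
  have hw := intervalIntegrable_of_dom hab.le (L2.integrable (H1.wd v))
  have hle := L2.integral_abs_le hab.le (H1.wd v)
  rw [integral_dom hab.le] at hle
  filter_upwards [hV, ae_restrict_mem measurableSet_Ioo] with x hx hxm
  have hxI := Ioo_subset_Icc_self hxm
  have hi1 : IntervalIntegrable (H1.wd v) volume a x :=
    hw.mono_set (by rw [uIcc_of_le hxm.1.le, uIcc_of_le hab.le]; exact Icc_subset_Icc le_rfl hxm.2.le)
  have hi2 : IntervalIntegrable (H1.wd v) volume x b :=
    hw.mono_set (by rw [uIcc_of_le hxm.2.le, uIcc_of_le hab.le]; exact Icc_subset_Icc hxm.1.le le_rfl)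
  have e1 := hP.integral_eq hab.le (left_mem_Icc.2 hab.le) hxI hxm.1.le
  have e2 := hP.integral_eq hab.le hxI (right_mem_Icc.2 hab.le) hxm.2.le
  have b1 := intervalIntegral.abs_integral_le_integral_abs (f := H1.wd v) (μ := volume) hxm.1.le
  have b2 := intervalIntegral.abs_integral_le_integral_abs (f := H1.wd v) (μ := volume) hxm.2.le
  rw [e1, ha, sub_zero] at b1
  rw [e2, hb, zero_sub, abs_neg] at b2
  -- `|V x|` is at most the variation on `[a, x]` and at most that on `[x, b]`; adding the two
  -- bounds produces the factor one half.
  rw [← intervalIntegral.integral_add_adjacent_intervals hi1.abs hi2.abs, Real.sqrt_eq_rpow] at hle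
  rw [hx]
  linarith

/-- The Poincaré inequality with the sharp constant, for test functions. -/
theorem IsTest.poincare {a b : ℝ} (hab : a < b) {η : ℝ → ℝ} (hη : IsTest a b η) :
    ∫ x, η x ^ 2 ≤ ((b - a) / Real.pi) ^ 2 * ∫ x, deriv η x ^ 2 := by
  have hpos : 0 < b - a := sub_pos.2 hab
  set ν := Real.pi / (b - a) with hν
  have hνpos : 0 < ν := div_pos Real.pi_pos hpos
  have hsin : ∀ x ∈ Ioo a b, Real.sin (ν * (x - a)) ≠ 0 := by
    intro x hx
    refine (Real.sin_pos_of_pos_of_lt_pi (mul_pos hνpos (sub_pos.2 hx.1)) ?_).ne'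
    calc ν * (x - a) < ν * (b - a) := by
          exact mul_lt_mul_of_pos_left (by linarith [hx.2]) hνpos
      _ = Real.pi := by rw [hν]; field_simp
  -- `κ` is the logarithmic derivative of the first Dirichlet eigenfunction `sin (ν (x - a))`. It
  -- satisfies the Riccati equation `κ' = -ν² - κ²`, which is what makes the square below complete.
  set κ : ℝ → ℝ := fun x => ν * (Real.cos (ν * (x - a)) / Real.sin (ν * (x - a))) with hκ
  have hκd : ∀ x ∈ Ioo a b, HasDerivAt κ (-ν ^ 2 - κ x ^ 2) x := by
    intro x hx
    have hl : HasDerivAt (fun x => ν * (x - a)) ν x := by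
      simpa using ((hasDerivAt_id x).sub_const a).const_mul ν
    have hs := hsin x hx
    have h1 : HasDerivAt κ _ x := (hl.cos.div hl.sin hs).const_mul ν
    refine h1.congr_deriv ?_
    simp only [hκ]
    field_simp
  have hηd : ∀ x, HasDerivAt η (deriv η x) x :=
    fun x => (hη.smooth.differentiable (by simp) x).hasDerivAt
  have hηc : Continuous (deriv η) := hη.smooth.continuous_deriv (by simp)
  have hz : ∀ x, x ∉ tsupport η → η x = 0 := fun x hx => image_eq_zero_of_notMem_tsupport hx
  have hz' : ∀ x, x ∉ tsupport η → deriv η x = 0 := fun x hx =>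
    image_eq_zero_of_notMem_tsupport fun h => hx (tsupport_deriv_subset (𝕜 := ℝ) h)
  -- `κ` is singular at the end points, but it only occurs multiplied by functions that vanish off
  -- the support of `η`, so the products are globally continuous.
  have hcont : ∀ {q p : ℝ → ℝ}, ContinuousOn q (Ioo a b) → Continuous p →
      (∀ x, x ∉ tsupport η → p x = 0) → Continuous (fun x => q x * p x) := by
    intro q p hq hp hp0
    refine continuous_iff_continuousAt.2 fun x => ?_
    by_cases hx : x ∈ tsupport η
    · exact (hq.continuousAt (isOpen_Ioo.mem_nhds (hη.supp hx))).mul hp.continuousAt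
    · refine ContinuousAt.congr (f := fun _ => 0) continuousAt_const ?_
      filter_upwards [(isClosed_tsupport η).isOpen_compl.mem_nhds hx] with y hy
      rw [hp0 y hy, mul_zero]
  have hκc : ContinuousOn κ (Ioo a b) := fun x hx => (hκd x hx).continuousAt.continuousWithinAt
  set F : ℝ → ℝ := fun x => κ x * η x ^ 2
  set F' : ℝ → ℝ := fun x => (-ν ^ 2 - κ x ^ 2) * η x ^ 2 + (2 * κ x) * (η x * deriv η x)
  have hFd : ∀ x, HasDerivAt F (F' x) x := by
    intro x
    by_cases hx : x ∈ tsupport η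
    · convert! (hκd x (hη.supp hx)).mul ((hηd x).pow 2) using 1
      simp only [F', Pi.pow_apply]
      push_cast
      ring
    · have h0 : F' x = 0 := by simp [F', hz x hx]
      rw [h0]
      refine (hasDerivAt_const x (0 : ℝ)).congr_of_eventuallyEq ?_
      filter_upwards [(isClosed_tsupport η).isOpen_compl.mem_nhds hx] with y hy
      simp [F, hz y hy]
  have hF'c : Continuous F' := by
    refine (hcont (by fun_prop) (hη.smooth.continuous.pow 2) ?_).add (hcont (by fun_prop)
      (hη.smooth.continuous.mul hηc) ?_)
    · intro x hx; simp [hz x hx]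
    · intro x hx; simp [hz x hx]
  have hcs : ∀ {p : ℝ → ℝ}, (∀ x, x ∉ tsupport η → p x = 0) → HasCompactSupport p := fun h =>
    HasCompactSupport.intro hη.compact h
  have hF's : HasCompactSupport F' := hcs fun x hx => by simp [F', hz x hx]
  have hFs : HasCompactSupport F := hcs fun x hx => by simp [F, hz x hx]
  have hFc : Continuous F := continuous_iff_continuousAt.2 fun x => (hFd x).continuousAt
  have hI := integral_eq_zero_of_hasDerivAt_of_integrable hFd
    (hF'c.integrable_of_hasCompactSupport hF's) (hFc.integrable_of_hasCompactSupport hFs)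
  have i1 : Integrable (fun x => η x ^ 2) := (hη.smooth.continuous.pow 2).integrable_of_hasCompactSupport
    (hcs fun x hx => by simp [hz x hx])
  have i2 : Integrable (fun x => deriv η x ^ 2) := (hηc.pow 2).integrable_of_hasCompactSupport
    (hcs fun x hx => by simp [hz' x hx])
  -- The integrand is `(η' - κ η)²`, and `F' = (κ η²)'` integrates to zero.
  have hmain : 0 ≤ ∫ x, (deriv η x ^ 2 - ν ^ 2 * η x ^ 2 - F' x) := by
    refine integral_nonneg fun x => ?_
    have : deriv η x ^ 2 - ν ^ 2 * η x ^ 2 - F' x = (deriv η x - κ x * η x) ^ 2 := by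
      simp only [F']; ring
    simp only [this]
    exact sq_nonneg _
  rw [integral_sub (f := fun x => deriv η x ^ 2 - ν ^ 2 * η x ^ 2) (i2.sub (i1.const_mul _)) (hF'c.integrable_of_hasCompactSupport hF's),
    integral_sub i2 (i1.const_mul _), integral_const_mul, hI] at hmain
  have hc : ((b - a) / Real.pi) ^ 2 * ν ^ 2 = 1 := by
    rw [← mul_pow, hν]
    have := Real.pi_pos
    field_simp
  calc ∫ x, η x ^ 2 = ((b - a) / Real.pi) ^ 2 * (ν ^ 2 * ∫ x, η x ^ 2) := by
        rw [← mul_assoc, hc, one_mul]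
    _ ≤ _ := mul_le_mul_of_nonneg_left (by linarith) (sq_nonneg _)

/-- The Poincaré inequality with the sharp constant. -/
theorem H10Sub.poincare {a b : ℝ} (hab : a < b) {v : H1 a b} (hv : v ∈ H10Sub a b) :
    ‖H1.fn v‖ ≤ (b - a) / Real.pi * ‖H1.wd v‖ := by
  have hc : IsClosed {v : H1 a b | ‖H1.fn v‖ ≤ (b - a) / Real.pi * ‖H1.wd v‖} :=
    isClosed_le (by fun_prop) (by fun_prop)
  refine closure_minimal ?_ hc hv
  rintro w ⟨η, hη, h1, h2⟩
  have hpos : 0 ≤ (b - a) / Real.pi := div_nonneg (by linarith) Real.pi_pos.le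
  refine le_of_sq_le_sq ?_ (mul_nonneg hpos (norm_nonneg _))
  rw [mul_pow, L2.norm_sq_eq, L2.norm_sq_eq]
  rw [integral_congr_ae (f := fun x => H1.fn w x ^ 2) (g := fun x => η x ^ 2) (by filter_upwards [h1] with x hx; rw [hx]),
    integral_congr_ae (f := fun x => H1.wd w x ^ 2) (g := fun x => deriv η x ^ 2) (by filter_upwards [h2] with x hx; rw [hx]),
    setIntegral_eq_integral_of_forall_compl_eq_zero, setIntegral_eq_integral_of_forall_compl_eq_zero]
  · exact hη.poincare hab
  · intro x hx
    rw [image_eq_zero_of_notMem_tsupport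
      fun h => hx (hη.supp ((tsupport_deriv_subset (𝕜 := ℝ)) h))]
    simp
  · intro x hx
    rw [image_eq_zero_of_notMem_tsupport fun h => hx (hη.supp h)]
    simp

/-! ### Variational solutions of the Neumann problem -/

/-- Zarantonello's theorem: a strongly monotone Lipschitz map of a Hilbert space has a zero. -/
theorem exists_eq_zero_of_strongly_monotone {E : Type*} [NormedAddCommGroup E]
    [InnerProductSpace ℝ E] [CompleteSpace E] (A : E → E) {m L : ℝ} (hm : 0 < m)
    (hL : ∀ v w, ‖A v - A w‖ ≤ L * ‖v - w‖)
    (hA : ∀ v w, m * ‖v - w‖ ^ 2 ≤ inner ℝ (A v - A w) (v - w)) : ∃ v, A v = 0 := by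
  -- Enlarging the Lipschitz constant to at least `m` makes it positive and keeps `q` nonnegative.
  set K := max L m with hK
  have hKpos : 0 < K := lt_max_of_lt_right hm
  have hmK : m ≤ K := le_max_right _ _
  have hLK : ∀ v w, ‖A v - A w‖ ≤ K * ‖v - w‖ := fun v w =>
    (hL v w).trans (mul_le_mul_of_nonneg_right (le_max_left _ _) (norm_nonneg _))
  -- This step size minimizes `1 - 2 r m + r² K²`, the squared Lipschitz bound for `v ↦ v - r A v`;
  -- the minimum is `q`.
  set r := m / K ^ 2 with hr
  have hrpos : 0 < r := div_pos hm (pow_pos hKpos 2)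
  set q := 1 - m ^ 2 / K ^ 2 with hq
  have hq1 : q < 1 := by
    rw [hq]; linarith [div_pos (pow_pos hm 2) (pow_pos hKpos 2)]
  have hq0 : 0 ≤ q := by
    rw [hq, sub_nonneg, div_le_one (pow_pos hKpos 2)]
    exact pow_le_pow_left₀ hm.le hmK 2
  have hlip : ∀ v w, ‖(v - r • A v) - (w - r • A w)‖ ≤ √q * ‖v - w‖ := by
    intro v w
    refine le_of_sq_le_sq ?_ (by positivity)
    rw [mul_pow, Real.sq_sqrt hq0]
    have e : (v - r • A v) - (w - r • A w) = (v - w) - r • (A v - A w) := by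
      rw [smul_sub]; abel
    rw [e, norm_sub_sq_real, real_inner_smul_right, norm_smul, Real.norm_of_nonneg hrpos.le,
      real_inner_comm]
    have h1 := hA v w
    have h2 : ‖A v - A w‖ ^ 2 ≤ K ^ 2 * ‖v - w‖ ^ 2 := by
      rw [← mul_pow]; exact pow_le_pow_left₀ (norm_nonneg _) (hLK v w) 2
    have h3 : r ^ 2 * ‖A v - A w‖ ^ 2 ≤ r ^ 2 * (K ^ 2 * ‖v - w‖ ^ 2) :=
      mul_le_mul_of_nonneg_left h2 (sq_nonneg _)
    have h4 : r * (m * ‖v - w‖ ^ 2) ≤ r * inner ℝ (A v - A w) (v - w) :=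
      mul_le_mul_of_nonneg_left h1 hrpos.le
    have h5 : r ^ 2 * (K ^ 2 * ‖v - w‖ ^ 2) = m ^ 2 / K ^ 2 * ‖v - w‖ ^ 2 := by
      rw [hr]; field_simp
    have h6 : r * (m * ‖v - w‖ ^ 2) = m ^ 2 / K ^ 2 * ‖v - w‖ ^ 2 := by
      rw [hr]; field_simp
    rw [mul_pow, hq]
    linarith
  have hc : ContractingWith ⟨√q, Real.sqrt_nonneg q⟩ (fun v => v - r • A v) := by
    refine ⟨?_, LipschitzWith.of_dist_le_mul fun v w => ?_⟩
    · show √q < 1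
      exact (Real.sqrt_lt' one_pos).2 (by simpa using hq1)
    · rw [dist_eq_norm, dist_eq_norm]
      exact hlip v w
  refine ⟨hc.fixedPoint, ?_⟩
  have h := hc.fixedPoint_isFixedPt
  have h1 : r • A (hc.fixedPoint) = 0 := sub_eq_self.1 h
  exact (smul_eq_zero.1 h1).resolve_left (ne_of_gt hrpos)

/-- `v` is the weak solution of `k v - v'' = f` with homogeneous Neumann conditions. -/
def IsVarSol {a b : ℝ} (k : ℝ) (f : L2 a b) (v : H1 a b) : Prop :=
  ∀ w : H1 a b, k * inner ℝ (H1.fn v) (H1.fn w) + inner ℝ (H1.wd v) (H1.wd w)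
    = inner ℝ f (H1.fn w)

theorem solvesNeumann_iff {a b : ℝ} {k : ℝ} {F : ℝ → ℝ} {v : H1 a b} {f : L2 a b}
    (hf : f =ᵐ[dom a b] F) : SolvesNeumann k F v ↔ IsVarSol k f v := by
  have hF : MemLp F 2 (dom a b) := (memLp_congr_ae hf).1 (Lp.memLp f)
  rw [SolvesNeumann, and_iff_right hF]
  refine forall_congr' fun w => ?_
  rw [L2.inner_eq, L2.inner_eq, L2.inner_eq, ← integral_const_mul,
    integral_add ((L2.integrable_mul _ _).const_mul _) (L2.integrable_mul _ _),
    integral_congr_ae (f := fun x => f x * H1.fn w x) (g := fun x => F x * H1.fn w x)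
    (by filter_upwards [hf] with x hx; rw [hx])]

namespace IsVarSol

variable {a b k : ℝ} {f f' ρ : L2 a b} {v v' : H1 a b}

theorem add (h : IsVarSol k f v) (h' : IsVarSol k f' v') : IsVarSol k (f + f') (v + v') := by
  intro w
  rw [map_add, map_add, inner_add_left, inner_add_left, inner_add_left, ← h w, ← h' w]
  ring

theorem smul (c : ℝ) (h : IsVarSol k f v) : IsVarSol k (c • f) (c • v) := by
  intro w
  rw [map_smul, map_smul, real_inner_smul_left, real_inner_smul_left, real_inner_smul_left, ← h w]
  ring

theorem sub (h : IsVarSol k f v) (h' : IsVarSol k f' v') : IsVarSol k (f - f') (v - v') := by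
  simpa [sub_eq_add_neg] using h.add (h'.smul (-1))

/-- Testing only with `C_c^∞` functions turns the variational identity into `v'' = k v - f`; this is
the gain of regularity that puts products into `Y₂`. -/
theorem hasWeakDeriv_wd (hab : a ≤ b) (h : IsVarSol k f v) :
    HasWeakDeriv a b (H1.wd v) (k • H1.fn v - f) := by
  intro η hη
  obtain ⟨y, -, h1, h2⟩ := hη.exists_H1 hab
  have e : inner ℝ (H1.wd v) (H1.wd y) = -inner ℝ (k • H1.fn v - f) (H1.fn y) := by
    have := h y
    rw [inner_sub_left, real_inner_smul_left]
    linarith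
  rw [L2.inner_eq, L2.inner_eq] at e
  rw [integral_congr_ae (f := fun x => H1.wd v x * H1.wd y x)
      (g := fun x => H1.wd v x * deriv η x) (by filter_upwards [h2] with x hx; rw [hx]),
    integral_congr_ae (f := fun x => (k • H1.fn v - f : L2 a b) x * H1.fn y x)
      (g := fun x => (k • H1.fn v - f : L2 a b) x * η x)
      (by filter_upwards [h1] with x hx; rw [hx])] at e
  exact e

/-- The comparison source `ρ` is free: whatever part of `f` acts against `v` may be discarded. Each
later estimate is a choice of `ρ`. -/
theorem energy (h : IsVarSol k f v) (hρ : ∀ᵐ x ∂(dom a b), (f x - ρ x) * H1.fn v x ≤ 0) :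
    k * ‖H1.fn v‖ ^ 2 + ‖H1.wd v‖ ^ 2 ≤ ‖ρ‖ * ‖H1.fn v‖ := by
  have h1 := h v
  rw [real_inner_self_eq_norm_sq, real_inner_self_eq_norm_sq] at h1
  rw [h1]
  refine le_trans ?_ (real_inner_le_norm ρ (H1.fn v))
  rw [L2.inner_eq, L2.inner_eq]
  refine integral_mono_ae (L2.integrable_mul _ _) (L2.integrable_mul _ _) ?_
  filter_upwards [hρ] with x hx
  linarith

theorem norm_fn_le (hk : 0 < k) (h : IsVarSol k f v)
    (hρ : ∀ᵐ x ∂(dom a b), (f x - ρ x) * H1.fn v x ≤ 0) : ‖H1.fn v‖ ≤ k⁻¹ * ‖ρ‖ := by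
  have h1 := h.energy hρ
  rw [inv_mul_eq_div, le_div_iff₀ hk]
  by_contra! hlt
  have h0 : 0 < ‖H1.fn v‖ := by
    by_contra! h0
    have : ‖H1.fn v‖ = 0 := le_antisymm h0 (norm_nonneg _)
    rw [this] at hlt
    linarith [norm_nonneg ρ]
  nlinarith [sq_nonneg ‖H1.wd v‖, mul_lt_mul_of_pos_right hlt h0]

theorem norm_wd_le (hk : 0 < k) (h : IsVarSol k f v)
    (hρ : ∀ᵐ x ∂(dom a b), (f x - ρ x) * H1.fn v x ≤ 0) :
    ‖H1.wd v‖ ≤ k ^ (-(1 / 2) : ℝ) * ‖ρ‖ := by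
  have h1 := h.energy hρ
  have h2 := h.norm_fn_le hk hρ
  rw [Real.rpow_neg hk.le, ← Real.sqrt_eq_rpow]
  refine le_of_sq_le_sq ?_ (by positivity)
  rw [mul_pow, inv_pow, Real.sq_sqrt hk.le]
  -- The energy estimate and the bound for `‖v‖` give `‖v'‖² ≤ ‖ρ‖ ‖v‖ ≤ k⁻¹ ‖ρ‖²`.
  have h3 := mul_le_mul_of_nonneg_left h2 (norm_nonneg ρ)
  have h4 : 0 ≤ k * ‖H1.fn v‖ ^ 2 := by positivity
  nlinarith

/-- The difference satisfies the energy estimate with `ρ = 0`. -/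
theorem eq_of_ae (hk : 0 < k) (h : IsVarSol k f v) (h' : IsVarSol k f' v')
    (hρ : ∀ᵐ x ∂(dom a b), (f x - f' x) * (H1.fn v x - H1.fn v' x) ≤ 0) : v = v' := by
  have hρ' : ∀ᵐ x ∂(dom a b), ((f - f' : L2 a b) x - (0 : L2 a b) x) * H1.fn (v - v') x ≤ 0 := by
    rw [map_sub]
    filter_upwards [hρ, Lp.coeFn_sub f f', Lp.coeFn_sub (H1.fn v) (H1.fn v'),
      Lp.coeFn_zero ℝ 2 (dom a b)] with x hx h1 h2 h3
    rw [h1, h2, h3]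
    simpa using hx
  have h1 := (h.sub h').norm_fn_le hk hρ'
  have h2 := (h.sub h').norm_wd_le hk hρ'
  rw [norm_zero, mul_zero, norm_le_zero_iff, map_sub, sub_eq_zero] at h1 h2
  exact H1.ext' h1 h2

end IsVarSol

/-- Existence for the semilinear Neumann problem with a monotone Lipschitz nonlinearity. -/
theorem exists_isVarSol {a b k : ℝ} (hk : 0 < k) (N : L2 a b → L2 a b) {K : ℝ}
    (hN : ∀ v w, ‖N v - N w‖ ≤ K * ‖v - w‖) (hm : ∀ v w, inner ℝ (N v - N w) (v - w) ≤ 0) :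
    ∃ v : H1 a b, IsVarSol k (N (H1.fn v)) v := by
  let J : H1 a b →L[ℝ] L2 a b := H1.fn
  let D : H1 a b →L[ℝ] L2 a b := H1.wd
  -- The Riesz representative of the weak form, written with adjoints; its zeros are exactly the
  -- variational solutions. Monotonicity of `-N` makes it strongly monotone with constant `min k 1`.
  let A : H1 a b → H1 a b := fun v => J.adjoint (k • J v - N (J v)) + D.adjoint (D v)
  have hAi : ∀ v w, inner ℝ (A v) w = k * inner ℝ (J v) (J w) - inner ℝ (N (J v)) (J w)
      + inner ℝ (D v) (D w) := by
    intro v w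
    rw [inner_add_left, ContinuousLinearMap.adjoint_inner_left,
      ContinuousLinearMap.adjoint_inner_left, inner_sub_left, real_inner_smul_left]
  have hAs : ∀ v w, A v - A w = J.adjoint (k • J (v - w) - (N (J v) - N (J w)))
      + D.adjoint (D (v - w)) := by
    intro v w
    simp only [A, map_sub, smul_sub]
    abel
  have hAsi : ∀ v w z, inner ℝ (A v - A w) z = k * inner ℝ (J (v - w)) (J z)
      - inner ℝ (N (J v) - N (J w)) (J z) + inner ℝ (D (v - w)) (D z) := by
    intro v w z
    rw [hAs, inner_add_left, ContinuousLinearMap.adjoint_inner_left,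
      ContinuousLinearMap.adjoint_inner_left, inner_sub_left, real_inner_smul_left]
  obtain ⟨v, hv⟩ := exists_eq_zero_of_strongly_monotone A (m := min k 1)
    (L := ‖J.adjoint‖ * (k + |K|) * ‖J‖ + ‖D.adjoint‖ * ‖D‖) (lt_min hk one_pos)
    (by
      intro v w
      rw [hAs]
      have h0 : ‖J (v - w)‖ ≤ ‖J‖ * ‖v - w‖ := J.le_opNorm _
      have h1 : ‖k • J (v - w) - (N (J v) - N (J w))‖ ≤ (k + |K|) * (‖J‖ * ‖v - w‖) := by
        refine (norm_sub_le _ _).trans ?_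
        rw [norm_smul, Real.norm_of_nonneg hk.le, add_mul]
        refine add_le_add (mul_le_mul_of_nonneg_left h0 hk.le) ((hN _ _).trans ?_)
        rw [← map_sub]
        exact mul_le_mul (le_abs_self K) h0 (norm_nonneg _) (abs_nonneg _)
      have h2 : ‖D.adjoint (D (v - w))‖ ≤ ‖D.adjoint‖ * (‖D‖ * ‖v - w‖) :=
        (D.adjoint.le_opNorm _).trans (mul_le_mul_of_nonneg_left (D.le_opNorm _)
          (ContinuousLinearMap.opNorm_nonneg _))
      have h3 := (J.adjoint.le_opNorm (k • J (v - w) - (N (J v) - N (J w)))).trans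
        (mul_le_mul_of_nonneg_left h1 (ContinuousLinearMap.opNorm_nonneg _))
      refine (norm_add_le _ _).trans ((add_le_add h3 h2).trans (le_of_eq (by ring))))
    (by
      intro v w
      rw [hAsi, H1.norm_sq, real_inner_self_eq_norm_sq, real_inner_self_eq_norm_sq]
      have h1 := hm (J v) (J w)
      rw [← map_sub] at h1
      have h2 : min k 1 * ‖J (v - w)‖ ^ 2 ≤ k * ‖J (v - w)‖ ^ 2 :=
        mul_le_mul_of_nonneg_right (min_le_left _ _) (sq_nonneg _)
      have h3 : min k 1 * ‖D (v - w)‖ ^ 2 ≤ 1 * ‖D (v - w)‖ ^ 2 :=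
        mul_le_mul_of_nonneg_right (min_le_right _ _) (sq_nonneg _)
      show min k 1 * (‖J (v - w)‖ ^ 2 + ‖D (v - w)‖ ^ 2) ≤ _
      linarith)
  refine ⟨v, fun w => ?_⟩
  have h := hAi v w
  rw [hv, inner_zero_left] at h
  show k * inner ℝ (J v) (J w) + inner ℝ (D v) (D w) = inner ℝ (N (J v)) (J w)
  linarith

/-! ### Multiplication by bounded functions -/

/-- Multiplication of `L²(Ω)` by a function of `L^∞(Ω)`. -/
def L2.mul {a b : ℝ} {q : ℝ → ℝ} (hq : MemLp q ∞ (dom a b)) : L2 a b →L[ℝ] L2 a b :=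
  (ContinuousLinearMap.mul ℝ ℝ).holderL (dom a b) ∞ 2 2 (hq.toLp q)

theorem L2.coeFn_mul {a b : ℝ} {q : ℝ → ℝ} (hq : MemLp q ∞ (dom a b)) (v : L2 a b) :
    L2.mul hq v =ᵐ[dom a b] fun x => q x * v x := by
  filter_upwards [(ContinuousLinearMap.mul ℝ ℝ).coeFn_holder (r := 2) (hq.toLp q) v,
    hq.coeFn_toLp] with x h1 h2
  rw [← h2]
  exact h1

theorem L2.norm_mul_le {a b : ℝ} {q : ℝ → ℝ} (hq : MemLp q ∞ (dom a b)) (v : L2 a b) :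
    ‖L2.mul hq v‖ ≤ supNorm a b q * ‖v‖ := by
  have h := (ContinuousLinearMap.mul ℝ ℝ).norm_holder_apply_apply_le (r := 2) (hq.toLp q) v
  rw [Lp.norm_toLp] at h
  refine h.trans (mul_le_mul_of_nonneg_right ?_ (norm_nonneg _))
  exact mul_le_of_le_one_left ENNReal.toReal_nonneg (ContinuousLinearMap.opNorm_mul_le ℝ ℝ)

theorem memLp_top_of_continuous {a b : ℝ} {f : ℝ → ℝ} (hf : Continuous f) :
    MemLp f ∞ (dom a b) := by
  obtain ⟨C, hC⟩ := (isCompact_Icc (a := a) (b := b)).exists_bound_of_continuousOn hf.continuousOn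
  refine memLp_top_of_bound hf.aestronglyMeasurable C ?_
  filter_upwards [ae_restrict_mem measurableSet_Ioo] with x hx
  exact hC x (Ioo_subset_Icc_self hx)

theorem supNorm_nonneg (a b : ℝ) (f : ℝ → ℝ) : 0 ≤ supNorm a b f := ENNReal.toReal_nonneg

theorem ae_abs_le_supNorm {a b : ℝ} {f : ℝ → ℝ} (hf : MemLp f ∞ (dom a b)) :
    ∀ᵐ x ∂(dom a b), |f x| ≤ supNorm a b f := by
  filter_upwards [ae_le_eLpNormEssSup (f := f) (μ := dom a b)] with x hx
  rw [supNorm, eLpNorm_exponent_top]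
  have := ENNReal.toReal_mono (by simpa using hf.eLpNorm_ne_top) hx
  simpa using this

theorem supNorm_congr {a b : ℝ} {f f' : ℝ → ℝ} (h : f =ᵐ[dom a b] f') :
    supNorm a b f = supNorm a b f' := by
  rw [supNorm, supNorm, eLpNorm_congr_ae h]

/-- The product rule for weak derivatives. -/
theorem HasWeakDeriv.mul {a b : ℝ} (hab : a < b) {v w : L2 a b} (h : HasWeakDeriv a b v w)
    {φ : ℝ → ℝ} (hφ : ContDiff ℝ 1 φ) :
    HasWeakDeriv a b (L2.mul (memLp_top_of_continuous hφ.continuous) v)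
      (L2.mul (memLp_top_of_continuous (hφ.continuous_deriv le_rfl)) v
        + L2.mul (memLp_top_of_continuous hφ.continuous) w) := by
  obtain ⟨V, hV, hP⟩ := h.exists_isPrimitive hab
  refine hasWeakDeriv_of_isPrimitive hab.le (V := fun x => φ x * V x) ?_
    (((IsPrimitive.of_contDiff hφ).mul hab.le hP).congr_deriv ?_)
  · filter_upwards [L2.coeFn_mul (memLp_top_of_continuous hφ.continuous) v, hV] with x h1 h2
    rw [h1, h2]
  · filter_upwards [L2.coeFn_mul (memLp_top_of_continuous hφ.continuous) w, hV,
      L2.coeFn_mul (memLp_top_of_continuous (hφ.continuous_deriv le_rfl)) v,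
      Lp.coeFn_add (L2.mul (memLp_top_of_continuous (hφ.continuous_deriv le_rfl)) v)
        (L2.mul (memLp_top_of_continuous hφ.continuous) w)] with x h1 h2 h3 h4
    rw [h4, Pi.add_apply, h1, h3, h2]

theorem contDiff_one_deriv {φ : ℝ → ℝ} (hφ : ContDiff ℝ 2 φ) : ContDiff ℝ 1 (deriv φ) := by
  rw [show (2 : WithTop ℕ∞) = 1 + 1 by norm_num, contDiff_succ_iff_deriv] at hφ
  exact hφ.2.2

/-! ### Products of `H²(Ω)` functions with weights vanishing at the end points -/

/-- `H²(Ω)`: the pairs of an element of `H¹(Ω)` and its second weak derivative. -/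
def H2 (a b : ℝ) : Submodule ℝ (H1 a b × L2 a b) where
  carrier := {p | HasWeakDeriv a b (H1.wd p.1) p.2}
  add_mem' {p q} h h' := by
    simp only [mem_ofPred_eq, Prod.fst_add, Prod.snd_add, map_add]
    exact HasWeakDeriv.add h h'
  zero_mem' := by
    simp only [mem_ofPred_eq, Prod.fst_zero, Prod.snd_zero, map_zero]
    exact HasWeakDeriv.zero a b
  smul_mem' c p h := by
    simp only [mem_ofPred_eq, Prod.smul_fst, Prod.smul_snd, map_smul]
    exact HasWeakDeriv.smul c h

theorem H1.mk_mul_mem_H10Sub {a b : ℝ} (hab : a < b) (v : H1 a b) {φ : ℝ → ℝ}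
    (hφ : ContDiff ℝ 1 φ) (ha : φ a = 0) (hb : φ b = 0) :
    H1.mk ((H1.hasWeakDeriv v).mul hab hφ) ∈ H10Sub a b := by
  obtain ⟨V, hV, hP⟩ := H1.exists_isPrimitive hab v
  have hφ0 := memLp_top_of_continuous (a := a) (b := b) hφ.continuous
  have hφ1 := memLp_top_of_continuous (a := a) (b := b) (hφ.continuous_deriv le_rfl)
  refine H1.mem_H10Sub_of_eq_zero hab (V := fun x => φ x * V x) ?_
    (((IsPrimitive.of_contDiff hφ).mul hab.le hP).congr_deriv ?_) (by simp [ha]) (by simp [hb])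
  · filter_upwards [L2.coeFn_mul hφ0 (H1.fn v), hV] with x h1 h2
    rw [H1.fn_mk, h1, h2]
  · filter_upwards [L2.coeFn_mul hφ0 (H1.wd v), hV, L2.coeFn_mul hφ1 (H1.fn v),
      Lp.coeFn_add (L2.mul hφ1 (H1.fn v)) (L2.mul hφ0 (H1.wd v))] with x h1 h2 h3 h4
    rw [H1.wd_mk, h4, Pi.add_apply, h1, h3, h2]

namespace Y2

variable {a b : ℝ}

theorem ext' {y y' : Y2 a b} (h : H10.wd (toH10 y) = H10.wd (toH10 y')) (h' : lap y = lap y') :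
    y = y' :=
  Subtype.ext (WithLp.ofLp_injective 1 (Prod.ext (H10.wd_injective h) h'))

section

variable (hab : a < b) {φ : ℝ → ℝ} (hφ : ContDiff ℝ 2 φ) (ha : φ a = 0) (hb : φ b = 0)

/-- The product of a `C²`-function that vanishes at the end points with a function of `H²(Ω)`. -/
def mulFun (p : H2 a b) : Y2 a b :=
  ⟨WithLp.toLp 1 ((⟨H1.mk ((H1.hasWeakDeriv p.1.1).mul hab (hφ.of_le one_le_two)),
      H1.mk_mul_mem_H10Sub hab p.1.1 (hφ.of_le one_le_two) ha hb⟩ : H10Sub a b),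
      -- The Leibniz expansion `(φ''v + φ'v') + (φ'v' + φv'')`, grouped as the derivatives of `φ'v`
      -- and `φv'`.
      (L2.mul (memLp_top_of_continuous ((contDiff_one_deriv hφ).continuous_deriv le_rfl))
          (H1.fn p.1.1)
        + L2.mul (memLp_top_of_continuous (contDiff_one_deriv hφ).continuous) (H1.wd p.1.1))
      + (L2.mul (memLp_top_of_continuous (contDiff_one_deriv hφ).continuous) (H1.wd p.1.1)
        + L2.mul (memLp_top_of_continuous hφ.continuous) p.1.2)),
    ((H1.hasWeakDeriv p.1.1).mul hab (contDiff_one_deriv hφ)).add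
      (HasWeakDeriv.mul hab p.2 (hφ.of_le one_le_two))⟩

theorem wd_mulFun (p : H2 a b) : H10.wd (toH10 (mulFun hab hφ ha hb p))
    = L2.mul (memLp_top_of_continuous (contDiff_one_deriv hφ).continuous) (H1.fn p.1.1)
      + L2.mul (memLp_top_of_continuous hφ.continuous) (H1.wd p.1.1) := rfl

theorem lap_mulFun (p : H2 a b) : lap (mulFun hab hφ ha hb p)
    = (L2.mul (memLp_top_of_continuous ((contDiff_one_deriv hφ).continuous_deriv le_rfl))
          (H1.fn p.1.1)
        + L2.mul (memLp_top_of_continuous (contDiff_one_deriv hφ).continuous) (H1.wd p.1.1))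
      + (L2.mul (memLp_top_of_continuous (contDiff_one_deriv hφ).continuous) (H1.wd p.1.1)
        + L2.mul (memLp_top_of_continuous hφ.continuous) p.1.2) := rfl

/-- `Y2.mulFun` as a linear map from `H²(Ω)` to `Y₂`. -/
def mulMap : H2 a b →ₗ[ℝ] Y2 a b where
  toFun := mulFun hab hφ ha hb
  map_add' p q := by
    refine ext' ?_ ?_
    · simp only [map_add, wd_mulFun, Submodule.coe_add, Prod.fst_add]
      abel
    · simp only [map_add, lap_mulFun, Submodule.coe_add, Prod.fst_add, Prod.snd_add]
      abel
  map_smul' c p := by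
    refine ext' ?_ ?_
    · simp only [map_smul, wd_mulFun, Submodule.coe_smul, Prod.smul_fst, smul_add, RingHom.id_apply]
    · simp only [map_smul, lap_mulFun, Submodule.coe_smul, Prod.smul_fst, Prod.smul_snd, smul_add,
        RingHom.id_apply]

theorem isFn_mulMap (p : H2 a b) :
    IsFn (mulMap hab hφ ha hb p) (fun x => φ x * H1.fn p.1.1 x) :=
  L2.coeFn_mul (memLp_top_of_continuous hφ.continuous) (H1.fn p.1.1)

theorem norm_toH10_mulMap_le (p : H2 a b) : ‖toH10 (mulMap hab hφ ha hb p)‖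
    ≤ supNorm a b (deriv φ) * ‖H1.fn p.1.1‖ + supNorm a b φ * ‖H1.wd p.1.1‖ := by
  rw [H10.norm_eq]
  exact (norm_add_le _ _).trans (add_le_add (L2.norm_mul_le _ _) (L2.norm_mul_le _ _))

theorem norm_mulMap_le (p : H2 a b) : ‖mulMap hab hφ ha hb p‖
    ≤ (supNorm a b φ + 2 * supNorm a b (deriv φ) + supNorm a b (deriv (deriv φ)))
      * (‖H1.fn p.1.1‖ + ‖H1.wd p.1.1‖ + ‖p.1.2‖) := by
  have h1 := norm_toH10_mulMap_le hab hφ ha hb p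
  have h2 : ‖lap (mulMap hab hφ ha hb p)‖
      ≤ (supNorm a b (deriv (deriv φ)) * ‖H1.fn p.1.1‖ + supNorm a b (deriv φ) * ‖H1.wd p.1.1‖)
      + (supNorm a b (deriv φ) * ‖H1.wd p.1.1‖ + supNorm a b φ * ‖p.1.2‖) :=
    (norm_add_le _ _).trans (add_le_add
      ((norm_add_le _ _).trans (add_le_add (L2.norm_mul_le _ _) (L2.norm_mul_le _ _)))
      ((norm_add_le _ _).trans (add_le_add (L2.norm_mul_le _ _) (L2.norm_mul_le _ _))))
  rw [norm_eq]
  have s0 := supNorm_nonneg a b φ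
  have s1 := supNorm_nonneg a b (deriv φ)
  have s2 := supNorm_nonneg a b (deriv (deriv φ))
  have n0 := norm_nonneg (H1.fn p.1.1)
  have n1 := norm_nonneg (H1.wd p.1.1)
  have n2 := norm_nonneg p.1.2
  -- After expansion these products are exactly the terms by which the right side exceeds the left.
  nlinarith [mul_nonneg s0 n0, mul_nonneg s1 n0, mul_nonneg s1 n2, mul_nonneg s2 n1,
    mul_nonneg s2 n2]

end

end Y2

/-! ### Extension of `C²`-functions -/

theorem eqOn_add_integral_of_derivWithin {a b : ℝ} (hab : a < b) {f D : ℝ → ℝ}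
    (hf : DifferentiableOn ℝ f (Icc a b)) (hD : Continuous D)
    (h : EqOn (derivWithin f (Icc a b)) D (Icc a b)) :
    EqOn (fun x => f a + ∫ t in a..x, D t) f (Icc a b) := by
  have hd : ∀ x, HasDerivAt (fun x => f a + ∫ t in a..x, D t) (D x) x := fun x =>
    (hD.integral_hasStrictDerivAt a x).hasDerivAt.const_add _
  refine eq_of_derivWithin_eq (fun x _ => (hd x).differentiableAt.differentiableWithinAt) hf
    (fun x hx => ?_) (by simp)
  have hx' := Ico_subset_Icc_self hx
  rw [(hd x).hasDerivWithinAt.derivWithin (uniqueDiffOn_Icc hab x hx'), h hx']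

/-- The products above need a weight that is smooth on the whole line. The second derivative is
extended by its end point values and integrated twice. -/
theorem exists_contDiff_eqOn {a b : ℝ} (hab : a < b) {φ : ℝ → ℝ}
    (hφ : ContDiffOn ℝ 2 φ (Icc a b)) : ∃ Φ : ℝ → ℝ, ContDiff ℝ 2 Φ ∧ EqOn Φ φ (Icc a b) := by
  have hu := uniqueDiffOn_Icc hab
  have h1 : ContDiffOn ℝ 1 (derivWithin φ (Icc a b)) (Icc a b) := hφ.derivWithin hu (by norm_num)
  have h2 : ContinuousOn (derivWithin (derivWithin φ (Icc a b)) (Icc a b)) (Icc a b) :=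
    h1.continuousOn_derivWithin hu le_rfl
  set d1 := derivWithin φ (Icc a b)
  set D2 : ℝ → ℝ := IccExtend hab.le ((Icc a b).domRestrict (derivWithin d1 (Icc a b))) with hD2
  have hD2c : Continuous D2 := (continuousOn_iff_continuous_domRestrict.1 h2).Icc_extend'
  have hD2e : EqOn (derivWithin d1 (Icc a b)) D2 (Icc a b) := fun x hx => by
    rw [hD2, IccExtend_of_mem hab.le _ hx]
    rfl
  set D1 : ℝ → ℝ := fun x => d1 a + ∫ t in a..x, D2 t with hD1
  have hD1d : ∀ x, HasDerivAt D1 (D2 x) x := fun x =>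
    (hD2c.integral_hasStrictDerivAt a x).hasDerivAt.const_add _
  have hD1e : EqOn D1 d1 (Icc a b) :=
    eqOn_add_integral_of_derivWithin hab (h1.differentiableOn one_ne_zero) hD2c hD2e
  have hD1C : ContDiff ℝ 1 D1 := by
    rw [contDiff_one_iff_deriv]
    refine ⟨fun x => (hD1d x).differentiableAt, ?_⟩
    rwa [show deriv D1 = D2 from funext fun x => (hD1d x).deriv]
  have hD0d : ∀ x, HasDerivAt (fun x => φ a + ∫ t in a..x, D1 t) (D1 x) x := fun x =>
    (hD1C.continuous.integral_hasStrictDerivAt a x).hasDerivAt.const_add _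
  refine ⟨fun x => φ a + ∫ t in a..x, D1 t, ?_, eqOn_add_integral_of_derivWithin hab
    (hφ.differentiableOn two_ne_zero) hD1C.continuous hD1e.symm⟩
  rw [show (2 : WithTop ℕ∞) = 1 + 1 by norm_num, contDiff_succ_iff_deriv]
  refine ⟨fun x => (hD0d x).differentiableAt, by simp, ?_⟩
  rwa [show deriv (fun x => φ a + ∫ t in a..x, D1 t) = D1 from funext fun x => (hD0d x).deriv]

/-- Both norms see the weight only on the open interval, where equality of the functions passes to
the derivatives. -/
theorem factor_congr {a b : ℝ} (k : ℝ) {φ Φ : ℝ → ℝ} (h : EqOn Φ φ (Icc a b)) :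
    factor a b k Φ = factor a b k φ := by
  have h1 : Φ =ᵐ[dom a b] φ := by
    filter_upwards [ae_restrict_mem measurableSet_Ioo] with x hx
    exact h (Ioo_subset_Icc_self hx)
  have h2 : deriv Φ =ᵐ[dom a b] deriv φ := by
    filter_upwards [ae_restrict_mem measurableSet_Ioo] with x hx
    refine EventuallyEq.deriv_eq ?_
    filter_upwards [isOpen_Ioo.mem_nhds hx] with y hy
    exact h (Ioo_subset_Icc_self hy)
  rw [factor, factor, supNorm_congr h1, supNorm_congr h2]

theorem factor_nonneg {a b k : ℝ} (hab : a < b) (hk : 0 < k) (φ : ℝ → ℝ) :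
    0 ≤ factor a b k φ := by
  have := supNorm_nonneg a b φ
  have := supNorm_nonneg a b (deriv φ)
  have := sub_pos.2 hab
  have := Real.pi_pos
  rw [factor]
  positivity

/-! ### Local Lipschitz constants and the Clarke differential -/

theorem lipOn_nonneg (g : ℝ → ℝ) (α β : ℝ) : 0 ≤ lipOn g α β :=
  Real.sInf_nonneg fun _ hc => hc.1

theorem abs_sub_le_lipOn {g : ℝ → ℝ} (hg : LocallyLipschitz g) {α β s t : ℝ}
    (hs : s ∈ Icc α β) (ht : t ∈ Icc α β) : |g s - g t| ≤ lipOn g α β * |s - t| := by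
  have hne : {c : ℝ | 0 ≤ c ∧ ∀ s ∈ Icc α β, ∀ t ∈ Icc α β, |g s - g t| ≤ c * |s - t|}.Nonempty := by
    obtain ⟨K, hK⟩ := (hg.locallyLipschitzOn (s := Icc α β)).exists_lipschitzOnWith_of_compact
      isCompact_Icc
    exact ⟨K, K.2, fun s hs t ht => by simpa [Real.dist_eq] using hK.dist_le_mul s hs t ht⟩
  rcases eq_or_ne s t with rfl | hst
  · simp
  have h0 : 0 < |s - t| := abs_pos.2 (sub_ne_zero.2 hst)
  rw [← div_le_iff₀ h0]
  refine le_csInf hne fun c hc => ?_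
  rw [div_le_iff₀ h0]
  exact hc.2 s hs t ht

theorem lipOn_le {g : ℝ → ℝ} {α β c : ℝ} (hc : 0 ≤ c)
    (h : ∀ s ∈ Icc α β, ∀ t ∈ Icc α β, |g s - g t| ≤ c * |s - t|) : lipOn g α β ≤ c :=
  csInf_le ⟨0, fun _ hc => hc.1⟩ ⟨hc, h⟩

theorem lipOn_mono {g : ℝ → ℝ} (hg : LocallyLipschitz g) {α β α' β' : ℝ} (hα : α' ≤ α)
    (hβ : β ≤ β') : lipOn g α β ≤ lipOn g α' β' :=
  lipOn_le (lipOn_nonneg _ _ _) fun _ hs _ ht =>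
    abs_sub_le_lipOn hg (Icc_subset_Icc hα hβ hs) (Icc_subset_Icc hα hβ ht)

theorem exists_tendsto_lipOn {g : ℝ → ℝ} (hg : LocallyLipschitz g) (M : ℝ) :
    ∃ L, Tendsto (fun t => lipOn g (-t) t) (𝓝[>] M) (𝓝 L) := by
  have hm : Monotone fun t => lipOn g (-t) t := fun s t h => lipOn_mono hg (neg_le_neg h) h
  exact ⟨_, hm.tendsto_nhdsGT M⟩

/-- The real-valued `limsup` is an infimum of eventual upper bounds and takes a default value if
these are unbounded below; the local Lipschitz bound excludes this. -/
theorem clarkeDirDeriv_le {g : ℝ → ℝ} (hg : LocallyLipschitz g) {s v C : ℝ}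
    (h : ∀ᶠ p : ℝ × ℝ in 𝓝 s ×ˢ 𝓝[>] (0 : ℝ), (g (p.1 + p.2 * v) - g p.1) / p.2 ≤ C) :
    clarkeDirDeriv g s v ≤ C := by
  refine limsup_le_of_le (IsBoundedUnder.isCoboundedUnder_le ?_) h
  have h1 : Tendsto (fun p : ℝ × ℝ => p.1) (𝓝 s ×ˢ 𝓝[>] (0 : ℝ)) (𝓝 s) := tendsto_fst
  have h2 : Tendsto (fun p : ℝ × ℝ => p.2) (𝓝 s ×ˢ 𝓝[>] (0 : ℝ)) (𝓝 0) :=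
    tendsto_snd.mono_right nhdsWithin_le_nhds
  have h3 : Tendsto (fun p : ℝ × ℝ => p.1 + p.2 * v) (𝓝 s ×ˢ 𝓝[>] (0 : ℝ)) (𝓝 s) := by
    simpa using h1.add (h2.mul_const v)
  have hn : Icc (s - 1) (s + 1) ∈ 𝓝 s := Icc_mem_nhds (by linarith) (by linarith)
  refine ⟨-(lipOn g (s - 1) (s + 1) * |v|), ?_⟩
  rw [eventually_map]
  filter_upwards [h1 hn, h3 hn, tendsto_snd.eventually (self_mem_nhdsWithin (s := Ioi (0 : ℝ)))]
    with p hp1 hp3 hp2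
  have hp2' : 0 < p.2 := hp2
  have h4 := abs_sub_le_lipOn hg hp3 hp1
  rw [add_sub_cancel_left, abs_mul, abs_of_pos hp2'] at h4
  show _ ≤ _
  rw [le_div_iff₀ hp2']
  linarith [neg_abs_le (g (p.1 + p.2 * v) - g p.1)]

/-- In direction `1` all difference quotients of a nonincreasing function are nonpositive. -/
theorem nonpos_of_mem_clarkeDifferential {g : ℝ → ℝ} (hg : LocallyLipschitz g) (hgm : Antitone g)
    {s ζ : ℝ} (hζ : ζ ∈ clarkeDifferential g s) : ζ ≤ 0 := by
  have h := (hζ 1).trans (clarkeDirDeriv_le hg (C := 0) ?_)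
  · simpa using h
  · filter_upwards [tendsto_snd.eventually (self_mem_nhdsWithin (s := Ioi (0 : ℝ)))] with p hp
    have hp' : 0 < p.2 := hp
    refine div_nonpos_of_nonpos_of_nonneg (sub_nonpos.2 (hgm ?_)) hp'.le
    linarith

/-- Since `ζ ≤ 0`, direction `-1` suffices. The strict inequality `|s| < t` keeps both points of the
nearby difference quotients in `[-t, t]`; this is why the derivative bound needs a limit from the
right. -/
theorem abs_le_lipOn_of_mem_clarkeDifferential {g : ℝ → ℝ} (hg : LocallyLipschitz g)
    (hgm : Antitone g) {s ζ t : ℝ} (hζ : ζ ∈ clarkeDifferential g s) (hs : |s| < t) :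
    |ζ| ≤ lipOn g (-t) t := by
  rw [abs_of_nonpos (nonpos_of_mem_clarkeDifferential hg hgm hζ)]
  have h := (hζ (-1)).trans (clarkeDirDeriv_le hg (C := lipOn g (-t) t) ?_)
  · simpa using h
  have h1 : Tendsto (fun p : ℝ × ℝ => p.1) (𝓝 s ×ˢ 𝓝[>] (0 : ℝ)) (𝓝 s) := tendsto_fst
  have h2 : Tendsto (fun p : ℝ × ℝ => p.2) (𝓝 s ×ˢ 𝓝[>] (0 : ℝ)) (𝓝 0) :=
    tendsto_snd.mono_right nhdsWithin_le_nhds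
  have h3 : Tendsto (fun p : ℝ × ℝ => p.1 + p.2 * (-1)) (𝓝 s ×ˢ 𝓝[>] (0 : ℝ)) (𝓝 s) := by
    simpa using h1.add (h2.mul_const (-1))
  have hn : Icc (-t) t ∈ 𝓝 s := Icc_mem_nhds (abs_lt.1 hs).1 (abs_lt.1 hs).2
  filter_upwards [h1 hn, h3 hn, tendsto_snd.eventually (self_mem_nhdsWithin (s := Ioi (0 : ℝ)))]
    with p hp1 hp3 hp2
  have hp2' : 0 < p.2 := hp2
  have h4 := abs_sub_le_lipOn hg hp3 hp1
  rw [add_sub_cancel_left, abs_mul, abs_of_pos hp2', abs_neg, abs_one, mul_one] at h4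
  rw [div_le_iff₀ hp2']
  linarith [le_abs_self (g (p.1 + p.2 * (-1)) - g p.1)]

/-! ### The state equation -/

variable {a b k R : ℝ} {ψ g : ℝ → ℝ}

theorem Antitone.mul_sub_nonpos (hg : Antitone g) {p s t r : ℝ} (hp : 0 ≤ p) :
    (g (p * s - r) - g (p * t - r)) * (s - t) ≤ 0 := by
  rcases le_total s t with h | h
  · refine mul_nonpos_of_nonneg_of_nonpos (sub_nonneg.2 (hg ?_)) (sub_nonpos.2 h)
    linarith [mul_le_mul_of_nonneg_left h hp]
  · refine mul_nonpos_of_nonpos_of_nonneg (sub_nonpos.2 (hg ?_)) (sub_nonneg.2 h)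
    linarith [mul_le_mul_of_nonneg_left h hp]

theorem IsState.exists_isVarSol {u : H10 a b} {T : H1 a b} (h : IsState k ψ g u T) :
    ∃ f : L2 a b, f =ᵐ[dom a b] (fun x => g (ψ x * H1.fn T x - H10.fn u x)) ∧ IsVarSol k f T :=
  ⟨h.1.toLp, h.1.coeFn_toLp, (solvesNeumann_iff h.1.coeFn_toLp).1 h⟩

theorem IsState.unique (hk : 0 < k) (hψ0 : 0 ≤ᵐ[dom a b] ψ) (hgm : Antitone g) {u : H10 a b}
    {T T' : H1 a b} (h : IsState k ψ g u T) (h' : IsState k ψ g u T') : T = T' := by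
  obtain ⟨f, hf, hfT⟩ := h.exists_isVarSol
  obtain ⟨f', hf', hfT'⟩ := h'.exists_isVarSol
  refine hfT.eq_of_ae hk hfT' ?_
  filter_upwards [hf, hf', hψ0] with x h1 h2 h3
  rw [h1, h2]
  exact Antitone.mul_sub_nonpos hgm h3

theorem H10.ae_abs_le (hab : a < b) {u : H10 a b} (hu : ‖u‖ ≤ R) :
    ∀ᵐ x ∂(dom a b), |H10.fn u x| ≤ boundN a b R := by
  filter_upwards [H10Sub.ae_abs_le hab (v := H10.toH1 u) u.2] with x hx
  refine hx.trans ?_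
  rw [boundN]
  have : ‖H1.wd (H10.toH1 u)‖ ≤ R := hu
  have hpos : 0 ≤ (b - a) ^ (1 / 2 : ℝ) := Real.rpow_nonneg (by linarith) _
  linarith [mul_le_mul_of_nonneg_left this hpos]

theorem H10.norm_fn_le (hab : a < b) (u : H10 a b) : ‖H10.fn u‖ ≤ (b - a) / Real.pi * ‖u‖ :=
  H10Sub.poincare hab (v := H10.toH1 u) u.2

theorem H10.fn_sub (u u' : H10 a b) : H10.fn (u - u') = H10.fn u - H10.fn u' := by
  rw [H10.fn, map_sub, map_sub]; rfl

theorem H10.fn_add (u u' : H10 a b) : H10.fn (u + u') = H10.fn u + H10.fn u' := by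
  rw [H10.fn, map_add, map_add]; rfl

theorem boundN_nonneg (hab : a < b) (hR : 0 ≤ R) : 0 ≤ boundN a b R := by
  have hpos : 0 ≤ (b - a) ^ (1 / 2 : ℝ) := Real.rpow_nonneg (by linarith) _
  rw [boundN]
  positivity

/-- A priori bound for the argument of the nonlinearity. -/
theorem IsState.ae_abs_le (hab : a < b) (hk : 0 < k) (hψ : MemLp ψ ∞ (dom a b))
    (hψ0 : 0 ≤ᵐ[dom a b] ψ) (hgc : Continuous g) (hgm : Antitone g) {L : ℝ}
    (hL0 : 0 ≤ L)
    (hL : ∀ s ∈ Icc (-boundN a b R) (boundN a b R), |g s - g 0| ≤ L * |s|) {u u' : H10 a b}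
    (hu : ‖u‖ ≤ R) (hu' : ‖u'‖ ≤ R) {T : H1 a b} (h : IsState k ψ g u T) :
    ∀ᵐ x ∂(dom a b), |ψ x * H1.fn T x - H10.fn u' x| ≤ boundN a b R + supNorm a b ψ
      * ((b - a) ^ (-(1 / 2) : ℝ) * k⁻¹ + (b - a) ^ (1 / 2 : ℝ) * k ^ (-(1 / 2) : ℝ))
      * ((L * (2 * boundN a b R / Real.pi) + |g 0|) * (b - a) ^ (1 / 2 : ℝ)) := by
  obtain ⟨f, hf, hfT⟩ := h.exists_isVarSol
  have hpos : 0 < b - a := sub_pos.2 hab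
  have hbound := H10.ae_abs_le hab hu
  have hle : ∀ᵐ x ∂(dom a b), |g (-H10.fn u x) - g 0| ≤ L * |H10.fn u x| := by
    filter_upwards [hbound] with x hx
    have := hL (-H10.fn u x) ⟨neg_le_neg (abs_le.1 hx).2, by linarith [(abs_le.1 hx).1]⟩
    rwa [abs_neg] at this
  have hm : AEStronglyMeasurable (fun x => g (-H10.fn u x) - g 0) (dom a b) :=
    (hgc.comp_aestronglyMeasurable (Lp.aestronglyMeasurable _).neg).sub aestronglyMeasurable_const
  have hM1 : MemLp (fun x => g (-H10.fn u x) - g 0) 2 (dom a b) :=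
    (Lp.memLp (H10.fn u)).of_le_mul hm hle
  have hM0 : MemLp (fun _ => g 0) 2 (dom a b) := memLp_const _
  -- The comparison source is `g(-u)`, the nonlinearity at `T = 0`. Its splitting into `g(-u) -
  -- g(0)` and `g(0)` produces the two summands in `M_R`.
  set ρ : L2 a b := hM1.toLp _ + hM0.toLp _ with hρ
  have hρe : ρ =ᵐ[dom a b] fun x => g (-H10.fn u x) := by
    filter_upwards [Lp.coeFn_add (hM1.toLp _) (hM0.toLp _), hM1.coeFn_toLp, hM0.coeFn_toLp]
      with x h1 h2 h3
    rw [hρ, h1, Pi.add_apply, h2, h3]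
    ring
  have hn1 : ‖hM1.toLp _‖ ≤ L * ‖H10.fn u‖ := by
    refine L2.norm_le_of_ae_le ?_
    filter_upwards [hM1.coeFn_toLp, hle] with x h1 h2
    rw [h1]; exact h2
  have hn0 : ‖hM0.toLp _‖ = |g 0| * (b - a) ^ (1 / 2 : ℝ) := by
    rw [← Real.sqrt_eq_rpow]
    refine (sq_eq_sq₀ (norm_nonneg _) (by positivity)).1 ?_
    rw [mul_pow, Real.sq_sqrt hpos.le, sq_abs, L2.norm_sq_eq,
      integral_congr_ae (g := fun _ => (g 0) ^ 2)
        (by filter_upwards [hM0.coeFn_toLp] with x hx; rw [hx])]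
    simp [hab.le, mul_comm]
  have hnu : ‖H10.fn u‖ ≤ 2 * boundN a b R / Real.pi * (b - a) ^ (1 / 2 : ℝ) := by
    refine (H10.norm_fn_le hab u).trans ?_
    have h1 : (b - a) / Real.pi * ‖u‖ ≤ (b - a) / Real.pi * R :=
      mul_le_mul_of_nonneg_left hu (div_nonneg hpos.le Real.pi_pos.le)
    refine h1.trans (le_of_eq ?_)
    have h2 : (b - a) ^ (1 / 2 : ℝ) * (b - a) ^ (1 / 2 : ℝ) = b - a := by
      rw [← Real.sqrt_eq_rpow]; exact Real.mul_self_sqrt hpos.le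
    rw [boundN]
    calc (b - a) / Real.pi * R
        = ((b - a) ^ (1 / 2 : ℝ) * (b - a) ^ (1 / 2 : ℝ)) / Real.pi * R := by rw [h2]
      _ = _ := by ring
  set B := (L * (2 * boundN a b R / Real.pi) + |g 0|) * (b - a) ^ (1 / 2 : ℝ) with hB
  have hρn : ‖ρ‖ ≤ B := by
    refine (norm_add_le _ _).trans ?_
    rw [hn0, hB]
    linarith [hn1, mul_le_mul_of_nonneg_left hnu hL0]
  have hρ' : ∀ᵐ x ∂(dom a b), (f x - ρ x) * H1.fn T x ≤ 0 := by
    filter_upwards [hf, hρe, hψ0] with x h1 h2 h3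
    rw [h1, h2]
    simpa using Antitone.mul_sub_nonpos (s := H1.fn T x) (t := 0) (r := H10.fn u x) hgm h3
  have e1 := (hfT.norm_fn_le hk hρ').trans
    (mul_le_mul_of_nonneg_left hρn (inv_nonneg.2 hk.le))
  have e2 := (hfT.norm_wd_le hk hρ').trans
    (mul_le_mul_of_nonneg_left hρn (Real.rpow_nonneg hk.le _))
  filter_upwards [H1.ae_abs_le hab T, H10.ae_abs_le hab hu', ae_abs_le_supNorm hψ] with x h1 h2 h3
  have h4 : |H1.fn T x| ≤ ((b - a) ^ (-(1 / 2) : ℝ) * k⁻¹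
      + (b - a) ^ (1 / 2 : ℝ) * k ^ (-(1 / 2) : ℝ)) * B := by
    refine h1.trans ?_
    have := mul_le_mul_of_nonneg_left e1 (Real.rpow_nonneg hpos.le (-(1 / 2)))
    have := mul_le_mul_of_nonneg_left e2 (Real.rpow_nonneg hpos.le (1 / 2))
    linarith
  have h5 : |ψ x * H1.fn T x| ≤ supNorm a b ψ * (((b - a) ^ (-(1 / 2) : ℝ) * k⁻¹
      + (b - a) ^ (1 / 2 : ℝ) * k ^ (-(1 / 2) : ℝ)) * B) := by
    rw [abs_mul]
    exact mul_le_mul h3 h4 (abs_nonneg _) (supNorm_nonneg _ _ _)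
  refine (abs_sub _ _).trans ?_
  rw [mul_assoc]
  linarith

theorem IsState.ae_abs_le_boundM (hab : a < b) (hk : 0 < k) (hψ : MemLp ψ ∞ (dom a b))
    (hψ0 : 0 ≤ᵐ[dom a b] ψ) (hg : LocallyLipschitz g) (hgm : Antitone g) (hR : 0 ≤ R)
    {u u' : H10 a b} (hu : ‖u‖ ≤ R) (hu' : ‖u'‖ ≤ R) {T : H1 a b} (h : IsState k ψ g u T) :
    ∀ᵐ x ∂(dom a b), |ψ x * H1.fn T x - H10.fn u' x| ≤ boundM a b k ψ g R := by
  have hN := boundN_nonneg hab hR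
  refine h.ae_abs_le hab hk hψ hψ0 hg.continuous hgm (lipOn_nonneg _ _ _) (fun s hs => ?_) hu hu'
  simpa using abs_sub_le_lipOn hg hs (t := 0) ⟨by linarith, hN⟩

theorem boundN_le_boundM (hab : a < b) (hk : 0 < k) (hR : 0 ≤ R) :
    boundN a b R ≤ boundM a b k ψ g R := by
  have h0 := boundN_nonneg hab hR
  have h1 := supNorm_nonneg a b ψ
  have h2 := lipOn_nonneg g (-boundN a b R) (boundN a b R)
  have h3 := sub_pos.2 hab
  have h4 := Real.pi_pos
  rw [boundM]
  exact le_add_of_nonneg_right (by positivity)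

theorem memLp_two_of_lipschitz {K : ℝ} (hK : ∀ s t, |g s - g t| ≤ K * |s - t|)
    {v : ℝ → ℝ} (hv : MemLp v 2 (dom a b)) : MemLp (fun x => g (v x)) 2 (dom a b) := by
  have hgc : Continuous g := (LipschitzWith.of_dist_le' (K := K) hK).continuous
  have h1 : MemLp (fun x => g (v x) - g 0) 2 (dom a b) :=
    hv.of_le_mul ((hgc.comp_aestronglyMeasurable hv.1).sub aestronglyMeasurable_const)
      (c := K) (Eventually.of_forall fun x => by simpa using hK (v x) 0)
  refine (memLp_congr_ae (Eventually.of_forall fun x => ?_)).1 (h1.add (memLp_const (g 0)))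
  simp

theorem memLp_two_state (hψ : MemLp ψ ∞ (dom a b)) (u v : L2 a b) :
    MemLp (fun x => ψ x * v x - u x) 2 (dom a b) := by
  refine (memLp_congr_ae ?_).1 (Lp.memLp (L2.mul hψ v - u))
  filter_upwards [L2.coeFn_mul hψ v, Lp.coeFn_sub (L2.mul hψ v) u] with x h1 h2
  rw [h2, Pi.sub_apply, h1]

theorem exists_isState_of_lipschitz (hk : 0 < k) (hψ : MemLp ψ ∞ (dom a b))
    (hψ0 : 0 ≤ᵐ[dom a b] ψ) (hgm : Antitone g) {K : ℝ} (hK : ∀ s t, |g s - g t| ≤ K * |s - t|)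
    (u : H10 a b) : ∃ T : H1 a b, IsState k ψ g u T := by
  have hK0 : 0 ≤ K := by simpa using (abs_nonneg _).trans (hK 1 0)
  have hmem : ∀ v : L2 a b, MemLp (fun x => g (ψ x * v x - H10.fn u x)) 2 (dom a b) := fun v =>
    memLp_two_of_lipschitz hK (memLp_two_state hψ (H10.fn u) v)
  obtain ⟨T, hT⟩ := NeumannObstacle.exists_isVarSol (a := a) (b := b) hk
    (fun v => (hmem v).toLp _) (K := K * supNorm a b ψ) (by
      intro v w
      refine L2.norm_le_of_ae_le ?_
      filter_upwards [Lp.coeFn_sub ((hmem v).toLp _) ((hmem w).toLp _), (hmem v).coeFn_toLp,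
        (hmem w).coeFn_toLp, Lp.coeFn_sub v w, ae_abs_le_supNorm hψ] with x h1 h2 h3 h4 h5
      rw [h1, Pi.sub_apply, h2, h3, h4, Pi.sub_apply]
      refine (hK _ _).trans ?_
      have e : ψ x * v x - H10.fn u x - (ψ x * w x - H10.fn u x) = ψ x * (v x - w x) := by ring
      rw [e, abs_mul, mul_assoc]
      exact mul_le_mul_of_nonneg_left (mul_le_mul_of_nonneg_right h5 (abs_nonneg _)) hK0) (by
      intro v w
      rw [L2.inner_eq]
      refine integral_nonpos_of_ae ?_
      filter_upwards [Lp.coeFn_sub ((hmem v).toLp _) ((hmem w).toLp _), (hmem v).coeFn_toLp,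
        (hmem w).coeFn_toLp, Lp.coeFn_sub v w, hψ0] with x h1 h2 h3 h4 h5
      rw [h1, Pi.sub_apply, h2, h3, h4, Pi.sub_apply]
      exact Antitone.mul_sub_nonpos hgm h5)
  exact ⟨T, (solvesNeumann_iff (hmem _).coeFn_toLp).2 hT⟩

theorem exists_isState (hab : a < b) (hk : 0 < k) (hψ : MemLp ψ ∞ (dom a b))
    (hψ0 : 0 ≤ᵐ[dom a b] ψ) (hg : LocallyLipschitz g) (hgm : Antitone g) (u : H10 a b) :
    ∃ T : H1 a b, IsState k ψ g u T := by
  set R := ‖u‖ with hR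
  have hR0 : 0 ≤ R := norm_nonneg u
  set M := boundM a b k ψ g R with hM
  have hN0 : 0 ≤ boundN a b R := boundN_nonneg hab hR0
  have hNM : boundN a b R ≤ M := boundN_le_boundM hab hk hR0
  have hM0 : -M ≤ M := by linarith
  -- Clipping to `[-M, M]` makes `g ∘ c` globally Lipschitz and keeps it nonincreasing.
  set c : ℝ → ℝ := fun s => projIcc (-M) M hM0 s with hc
  have hcm : Monotone c := fun s t h => monotone_projIcc hM0 h
  have hcI : ∀ s, c s ∈ Icc (-M) M := fun s => (projIcc (-M) M hM0 s).2
  have hce : ∀ s ∈ Icc (-M) M, c s = s := fun s hs => by rw [hc]; simp [projIcc_of_mem hM0 hs]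
  have hcl : ∀ s t, |c s - c t| ≤ |s - t| := fun s t => by
    simpa [Real.dist_eq, Subtype.dist_eq] using (LipschitzWith.projIcc hM0).dist_le_mul s t
  have hK : ∀ s t, |g (c s) - g (c t)| ≤ lipOn g (-M) M * |s - t| := fun s t =>
    (abs_sub_le_lipOn hg (hcI s) (hcI t)).trans
      (mul_le_mul_of_nonneg_left (hcl s t) (lipOn_nonneg _ _ _))
  have hgm' : Antitone fun s => g (c s) := fun s t h => hgm (hcm h)
  obtain ⟨T, hT⟩ := exists_isState_of_lipschitz hk hψ hψ0 hgm' hK u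
  refine ⟨T, ?_⟩
  have h0 : c 0 = 0 := hce 0 ⟨by linarith, by linarith⟩
  -- Because `N_R ≤ M`, clipping changes nothing on `[-N_R, N_R]` or at `0`. The a priori bound for
  -- `g ∘ c` is therefore the same `M`, and along the solution the clipping is inactive.
  have hb := hT.ae_abs_le (u' := u) (R := R) hab hk hψ hψ0
    (LipschitzWith.of_dist_le' (K := lipOn g (-M) M) hK).continuous hgm'
    (lipOn_nonneg g (-boundN a b R) (boundN a b R)) (by
      intro s hs
      rw [h0, hce s ⟨by linarith [hs.1], by linarith [hs.2]⟩]
      simpa using abs_sub_le_lipOn hg hs (t := 0) ⟨by linarith, hN0⟩) le_rfl le_rfl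
  rw [h0] at hb
  obtain ⟨f, hf, hfT⟩ := hT.exists_isVarSol
  refine (solvesNeumann_iff (f := f) ?_).2 hfT
  filter_upwards [hf, hb] with x h1 h2
  rw [h1, hce _ (abs_le.1 h2)]

/-- Stability of the state equation. -/
theorem IsState.sub_le (hab : a < b) (hk : 0 < k) (hψ : MemLp ψ ∞ (dom a b))
    (hψ0 : 0 ≤ᵐ[dom a b] ψ) (hg : LocallyLipschitz g) (hgm : Antitone g) (hR : 0 ≤ R)
    {u u' : H10 a b} (hu : ‖u‖ ≤ R) (hu' : ‖u'‖ ≤ R) {T T' : H1 a b} (h : IsState k ψ g u T)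
    (h' : IsState k ψ g u' T') :
    ‖H1.fn (T - T')‖ ≤ k⁻¹ * (lipOn g (-boundM a b k ψ g R) (boundM a b k ψ g R)
        * ((b - a) / Real.pi * ‖u - u'‖)) ∧
    ‖H1.wd (T - T')‖ ≤ k ^ (-(1 / 2) : ℝ) * (lipOn g (-boundM a b k ψ g R) (boundM a b k ψ g R)
        * ((b - a) / Real.pi * ‖u - u'‖)) := by
  set L := lipOn g (-boundM a b k ψ g R) (boundM a b k ψ g R) with hL
  obtain ⟨f, hf, hfT⟩ := h.exists_isVarSol
  obtain ⟨f', hf', hfT'⟩ := h'.exists_isVarSol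
  -- The intermediate value `g(ψT' - u)` separates the two changes: passing from `T` to `T'` with
  -- `u` fixed is monotone and is dropped, and only the change of `u` is estimated. The a priori
  -- bound is needed for `T'` paired with either of `u` and `u'`.
  have hle : ∀ᵐ x ∂(dom a b), |f' x - g (ψ x * H1.fn T' x - H10.fn u x)| ≤
      L * |H10.fn (u - u') x| := by
    rw [H10.fn_sub]
    filter_upwards [hf', h'.ae_abs_le_boundM hab hk hψ hψ0 hg hgm hR hu' hu,
      h'.ae_abs_le_boundM hab hk hψ hψ0 hg hgm hR hu' hu', Lp.coeFn_sub (H10.fn u) (H10.fn u')]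
      with x h1 h2 h3 h4
    rw [h1, h4, Pi.sub_apply]
    refine (abs_sub_le_lipOn hg (abs_le.1 h3) (abs_le.1 h2)).trans (le_of_eq ?_)
    congr 2
    ring
  have hρm : MemLp (fun x => g (ψ x * H1.fn T' x - H10.fn u x) - f' x) 2 (dom a b) := by
    refine (Lp.memLp (H10.fn (u - u'))).of_le_mul ((hg.continuous.comp_aestronglyMeasurable
      (memLp_two_state hψ _ _).1).sub (Lp.aestronglyMeasurable _)) (c := L) ?_
    filter_upwards [hle] with x hx
    rw [Real.norm_eq_abs, abs_sub_comm]
    exact hx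
  have hρn : ‖hρm.toLp _‖ ≤ L * ((b - a) / Real.pi * ‖u - u'‖) := by
    refine (L2.norm_le_of_ae_le (c := L) (w := H10.fn (u - u')) ?_).trans
      (mul_le_mul_of_nonneg_left (H10.norm_fn_le hab _) (lipOn_nonneg _ _ _))
    filter_upwards [hρm.coeFn_toLp, hle] with x h1 h2
    rw [h1, abs_sub_comm]
    exact h2
  have hρ : ∀ᵐ x ∂(dom a b), ((f - f' : L2 a b) x - hρm.toLp _ x) * H1.fn (T - T') x ≤ 0 := by
    rw [map_sub]
    filter_upwards [hρm.coeFn_toLp, Lp.coeFn_sub f f', Lp.coeFn_sub (H1.fn T) (H1.fn T'), hf, hψ0]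
      with x h1 h2 h3 h4 h5
    rw [h1, h2, h3, Pi.sub_apply, Pi.sub_apply, h4]
    have := Antitone.mul_sub_nonpos (s := H1.fn T x) (t := H1.fn T' x) (r := H10.fn u x) hgm h5
    convert this using 1
    ring
  exact ⟨((hfT.sub hfT').norm_fn_le hk hρ).trans (mul_le_mul_of_nonneg_left hρn (inv_nonneg.2 hk.le)),
    ((hfT.sub hfT').norm_wd_le hk hρ).trans
      (mul_le_mul_of_nonneg_left hρn (Real.rpow_nonneg hk.le _))⟩

/-! ### The linearized equation -/

theorem exists_isVarSol_linear (hk : 0 < k) (hψ : MemLp ψ ∞ (dom a b)) (hψ0 : 0 ≤ᵐ[dom a b] ψ)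
    {c : ℝ → ℝ} (hc : MemLp c ∞ (dom a b)) (hc0 : c ≤ᵐ[dom a b] 0) (h : L2 a b) :
    ∃ ξ : H1 a b, IsVarSol k (L2.mul hc (L2.mul hψ (H1.fn ξ)) - L2.mul hc h) ξ := by
  refine exists_isVarSol hk (fun v => L2.mul hc (L2.mul hψ v) - L2.mul hc h)
    (K := supNorm a b c * supNorm a b ψ) (fun v w => ?_) (fun v w => ?_)
  · rw [sub_sub_sub_cancel_right, ← map_sub, ← map_sub, mul_assoc]
    exact (L2.norm_mul_le hc _).trans
      (mul_le_mul_of_nonneg_left (L2.norm_mul_le hψ _) (supNorm_nonneg _ _ _))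
  · rw [sub_sub_sub_cancel_right, ← map_sub, ← map_sub, L2.inner_eq]
    refine integral_nonpos_of_ae ?_
    filter_upwards [L2.coeFn_mul hc (L2.mul hψ (v - w)), L2.coeFn_mul hψ (v - w), hψ0, hc0]
      with x h1 h2 h3 h4
    rw [h1, h2]
    have e : c x * (ψ x * (v - w : L2 a b) x) * (v - w : L2 a b) x
      = c x * (ψ x * ((v - w : L2 a b) x) ^ 2) := by ring
    rw [e]
    exact mul_nonpos_of_nonpos_of_nonneg h4 (mul_nonneg h3 (sq_nonneg _))

/-- The zero-order term `c ψ v` with `c ≤ 0 ≤ ψ` acts against `v`, so only `ρ` enters the energy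
estimate. -/
theorem ae_mul_nonpos_of_linear (hψ0 : 0 ≤ᵐ[dom a b] ψ) {c : ℝ → ℝ} (hc0 : c ≤ᵐ[dom a b] 0)
    {v f ρ : L2 a b} (hf : ∀ᵐ x ∂(dom a b), f x = c x * (ψ x * v x) + ρ x) :
    ∀ᵐ x ∂(dom a b), (f x - ρ x) * v x ≤ 0 := by
  filter_upwards [hf, hψ0, hc0] with x h1 h2 h3
  have e : (f x - ρ x) * v x = c x * (ψ x * v x ^ 2) := by rw [h1]; ring
  rw [e]
  exact mul_nonpos_of_nonpos_of_nonneg h3 (mul_nonneg h2 (sq_nonneg _))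

theorem linear_coeFn (hψ : MemLp ψ ∞ (dom a b)) {c : ℝ → ℝ} (hc : MemLp c ∞ (dom a b))
    (v h : L2 a b) : ∀ᵐ x ∂(dom a b), (L2.mul hc (L2.mul hψ v) - L2.mul hc h : L2 a b) x
      = c x * (ψ x * v x) - c x * h x := by
  filter_upwards [L2.coeFn_mul hc (L2.mul hψ v), L2.coeFn_mul hψ v, L2.coeFn_mul hc h,
    Lp.coeFn_sub (L2.mul hc (L2.mul hψ v)) (L2.mul hc h)] with x h1 h2 h3 h4
  rw [h4, Pi.sub_apply, h1, h2, h3]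

theorem linear_coeFn' (hψ : MemLp ψ ∞ (dom a b)) {c : ℝ → ℝ} (hc : MemLp c ∞ (dom a b))
    (v h : L2 a b) : ∀ᵐ x ∂(dom a b), (L2.mul hc (L2.mul hψ v) - L2.mul hc h : L2 a b) x
      = c x * (ψ x * v x) + (-L2.mul hc h : L2 a b) x := by
  filter_upwards [linear_coeFn hψ hc v h, L2.coeFn_mul hc h, Lp.coeFn_neg (L2.mul hc h)]
    with x h1 h2 h3
  rw [h1, h3, Pi.neg_apply, h2, sub_eq_add_neg]

theorem unique_isVarSol_linear (hk : 0 < k) (hψ : MemLp ψ ∞ (dom a b)) (hψ0 : 0 ≤ᵐ[dom a b] ψ)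
    {c : ℝ → ℝ} (hc : MemLp c ∞ (dom a b)) (hc0 : c ≤ᵐ[dom a b] 0) {h : L2 a b} {ξ ξ' : H1 a b}
    (hξ : IsVarSol k (L2.mul hc (L2.mul hψ (H1.fn ξ)) - L2.mul hc h) ξ)
    (hξ' : IsVarSol k (L2.mul hc (L2.mul hψ (H1.fn ξ')) - L2.mul hc h) ξ') : ξ = ξ' := by
  refine hξ.eq_of_ae hk hξ' ?_
  filter_upwards [linear_coeFn hψ hc (H1.fn ξ) h, linear_coeFn hψ hc (H1.fn ξ') h, hψ0, hc0]
    with x h1 h2 h3 h4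
  rw [h1, h2]
  have e : (c x * (ψ x * H1.fn ξ x) - c x * h x - (c x * (ψ x * H1.fn ξ' x) - c x * h x))
      * (H1.fn ξ x - H1.fn ξ' x) = c x * (ψ x * (H1.fn ξ x - H1.fn ξ' x) ^ 2) := by ring
  rw [e]
  exact mul_nonpos_of_nonpos_of_nonneg h4 (mul_nonneg h3 (sq_nonneg _))

/-- The solution operator of the linearized equation. -/
theorem exists_linear_solution (hk : 0 < k) (hψ : MemLp ψ ∞ (dom a b)) (hψ0 : 0 ≤ᵐ[dom a b] ψ)
    {c : ℝ → ℝ} (hc : MemLp c ∞ (dom a b)) (hc0 : c ≤ᵐ[dom a b] 0) :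
    ∃ S : L2 a b →ₗ[ℝ] H1 a b,
      ∀ h, IsVarSol k (L2.mul hc (L2.mul hψ (H1.fn (S h))) - L2.mul hc h) (S h) := by
  -- Linearity follows from uniqueness: sums and multiples of solutions solve the problem for the
  -- corresponding data.
  choose S hS using fun h => exists_isVarSol_linear (a := a) (b := b) hk hψ hψ0 hc hc0 h
  refine ⟨⟨⟨S, fun h h' => ?_⟩, fun r h => ?_⟩, hS⟩
  · refine unique_isVarSol_linear hk hψ hψ0 hc hc0 (hS _) ?_
    convert (hS h).add (hS h') using 1
    simp only [map_add]
    abel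
  · refine unique_isVarSol_linear hk hψ hψ0 hc hc0 (ξ' := r • S h) (hS _) ?_
    convert (hS h).smul r using 1
    simp only [map_smul, smul_sub]

/-! ### The product with the weight as an element of `Y₂` -/

section

variable (hab : a < b) {φ : ℝ → ℝ} (hφ : ContDiff ℝ 2 φ) (ha : φ a = 0) (hb : φ b = 0)

/-- The product `φ v ∈ Y₂` for the solution `v` of `k v - v'' = f`. -/
def weighted {f : L2 a b} {v : H1 a b} (h : IsVarSol k f v) : Y2 a b :=
  Y2.mulMap hab hφ ha hb ⟨(v, k • H1.fn v - f), h.hasWeakDeriv_wd hab.le⟩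

theorem weighted_sub {f f' : L2 a b} {v v' : H1 a b} (h : IsVarSol k f v)
    (h' : IsVarSol k f' v') : weighted hab hφ ha hb h - weighted hab hφ ha hb h'
      = weighted hab hφ ha hb (h.sub h') := by
  rw [weighted, weighted, weighted, ← map_sub]
  congr 1
  refine Subtype.ext (Prod.ext rfl ?_)
  show k • H1.fn v - f - (k • H1.fn v' - f') = k • H1.fn (v - v') - (f - f')
  rw [map_sub, smul_sub]
  abel

theorem isFn_weighted {f : L2 a b} {v : H1 a b} (h : IsVarSol k f v) :
    Y2.IsFn (weighted hab hφ ha hb h) (fun x => φ x * H1.fn v x) :=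
  Y2.isFn_mulMap hab hφ ha hb _

theorem norm_toH10_weighted_le {f : L2 a b} {v : H1 a b} (h : IsVarSol k f v) {B : ℝ}
    (h1 : ‖H1.fn v‖ ≤ k⁻¹ * B) (h2 : ‖H1.wd v‖ ≤ k ^ (-(1 / 2) : ℝ) * B) :
    ‖Y2.toH10 (weighted hab hφ ha hb h)‖ ≤ (supNorm a b φ * k ^ (-(1 / 2) : ℝ)
      + supNorm a b (deriv φ) * k⁻¹) * B := by
  refine (Y2.norm_toH10_mulMap_le hab hφ ha hb _).trans ?_
  have e1 := mul_le_mul_of_nonneg_left h1 (supNorm_nonneg a b (deriv φ))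
  have e2 := mul_le_mul_of_nonneg_left h2 (supNorm_nonneg a b φ)
  simp only
  linarith

theorem norm_weighted_le (hk : 0 < k) {f : L2 a b} {v : H1 a b} (h : IsVarSol k f v) :
    ‖weighted hab hφ ha hb h‖ ≤ (supNorm a b φ + 2 * supNorm a b (deriv φ)
      + supNorm a b (deriv (deriv φ))) * ((1 + k) * ‖H1.fn v‖ + ‖H1.wd v‖ + ‖f‖) := by
  have s0 := supNorm_nonneg a b φ
  have s1 := supNorm_nonneg a b (deriv φ)
  have s2 := supNorm_nonneg a b (deriv (deriv φ))
  refine (Y2.norm_mulMap_le hab hφ ha hb _).trans (mul_le_mul_of_nonneg_left ?_ (by positivity))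
  have := norm_sub_le (k • H1.fn v) f
  rw [norm_smul, Real.norm_of_nonneg hk.le] at this
  simp only
  linarith

/-- The derivative of the weighted solution operator. -/
theorem exists_weighted_linear (hk : 0 < k) (hψ : MemLp ψ ∞ (dom a b)) (hψ0 : 0 ≤ᵐ[dom a b] ψ)
    {c : ℝ → ℝ} (hc : MemLp c ∞ (dom a b)) (hc0 : c ≤ᵐ[dom a b] 0) :
    ∃ G : H10 a b →L[ℝ] Y2 a b, ∀ h, ∃ (ξ : H1 a b)
      (hξ : IsVarSol k (L2.mul hc (L2.mul hψ (H1.fn ξ)) - L2.mul hc (H10.fn h)) ξ),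
      G h = weighted hab hφ ha hb hξ := by
  obtain ⟨S, hS⟩ := exists_linear_solution hk hψ hψ0 hc hc0
  let J : H10 a b →ₗ[ℝ] L2 a b := (H1.fn : H1 a b →L[ℝ] L2 a b).toLinearMap ∘ₗ H10.toH1
  let F : H10 a b →ₗ[ℝ] L2 a b := ((L2.mul hc).comp (L2.mul hψ)).toLinearMap ∘ₗ
    (H1.fn : H1 a b →L[ℝ] L2 a b).toLinearMap ∘ₗ S ∘ₗ J - (L2.mul hc).toLinearMap ∘ₗ J
  -- `Q` pairs the solution `ξ` with its second derivative `k ξ - F h`, where `F h` is the full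
  -- right-hand side of its equation.
  let Q : H10 a b →ₗ[ℝ] H2 a b := LinearMap.codRestrict (H2 a b)
    ((S ∘ₗ J).prod (k • (H1.fn : H1 a b →L[ℝ] L2 a b).toLinearMap ∘ₗ S ∘ₗ J - F))
    (fun h => (hS (H10.fn h)).hasWeakDeriv_wd hab.le)
  have hG : ∀ h, Y2.mulMap hab hφ ha hb (Q h) = weighted hab hφ ha hb (hS (H10.fn h)) :=
    fun h => rfl
  have s0 := supNorm_nonneg a b φ
  have s1 := supNorm_nonneg a b (deriv φ)
  have s2 := supNorm_nonneg a b (deriv (deriv φ))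
  set Cφ := supNorm a b φ + 2 * supNorm a b (deriv φ) + supNorm a b (deriv (deriv φ)) with hCφ
  have hC0 : 0 ≤ Cφ := by positivity
  set C := supNorm a b c with hC
  have hC1 : 0 ≤ C := supNorm_nonneg _ _ _
  have hP := supNorm_nonneg a b ψ
  refine ⟨(Y2.mulMap hab hφ ha hb ∘ₗ Q).mkContinuous (Cφ * (((1 + k) * k⁻¹ * C
    + k ^ (-(1 / 2) : ℝ) * C + (C * (supNorm a b ψ * (k⁻¹ * C)) + C)) * ((b - a) / Real.pi)))
    (fun h => ?_), fun h => ⟨S (H10.fn h), hS _, rfl⟩⟩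
  show ‖Y2.mulMap hab hφ ha hb (Q h)‖ ≤ _
  rw [hG]
  refine (norm_weighted_le hab hφ ha hb hk _).trans ?_
  rw [mul_assoc]
  refine mul_le_mul_of_nonneg_left ?_ hC0
  have hm := ae_mul_nonpos_of_linear hψ0 hc0 (linear_coeFn' hψ hc (H1.fn (S (H10.fn h))) (H10.fn h))
  have hn : ‖-L2.mul hc (H10.fn h)‖ ≤ C * ‖H10.fn h‖ := by
    rw [norm_neg]; exact L2.norm_mul_le hc _
  have e1 := ((hS (H10.fn h)).norm_fn_le hk hm).trans
    (mul_le_mul_of_nonneg_left hn (inv_nonneg.2 hk.le))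
  have e2 := ((hS (H10.fn h)).norm_wd_le hk hm).trans
    (mul_le_mul_of_nonneg_left hn (Real.rpow_nonneg hk.le _))
  have e3 : ‖L2.mul hc (L2.mul hψ (H1.fn (S (H10.fn h)))) - L2.mul hc (H10.fn h)‖
      ≤ C * (supNorm a b ψ * (k⁻¹ * (C * ‖H10.fn h‖))) + C * ‖H10.fn h‖ := by
    refine (norm_sub_le _ _).trans (add_le_add ((L2.norm_mul_le hc _).trans
      (mul_le_mul_of_nonneg_left ((L2.norm_mul_le hψ _).trans
        (mul_le_mul_of_nonneg_left e1 hP)) hC1)) (L2.norm_mul_le hc _))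
  have e4 := H10.norm_fn_le hab h
  have e5 := mul_le_mul_of_nonneg_left e1 (by linarith : 0 ≤ 1 + k)
  have e6 : 0 ≤ (1 + k) * k⁻¹ * C + k ^ (-(1 / 2) : ℝ) * C
      + (C * (supNorm a b ψ * (k⁻¹ * C)) + C) := by positivity
  have e7 := mul_le_mul_of_nonneg_left e4 e6
  linarith

end

/-! ### Newton differentiability of superposition -/

theorem IsNewtonDifferentiable.exists_abs_le {Gg : ℝ → ℝ}
    (h : IsNewtonDifferentiable g (fun s => ContinuousLinearMap.toSpanSingleton ℝ (Gg s))) (s : ℝ)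
    {ε : ℝ} (hε : 0 < ε) :
    ∃ δ > 0, ∀ d, |d| < δ → |g (s + d) - g s - Gg (s + d) * d| ≤ ε * |d| := by
  have h1 := (h s).eventually (gt_mem_nhds hε)
  rw [eventually_nhdsWithin_iff, Metric.eventually_nhds_iff] at h1
  obtain ⟨δ, hδ, h1⟩ := h1
  refine ⟨δ, hδ, fun d hd => ?_⟩
  rcases eq_or_ne d 0 with rfl | hd0
  · simp
  have h2 := h1 (y := d) (by simpa using hd) hd0
  rw [Real.norm_eq_abs d, div_lt_iff₀ (abs_pos.2 hd0)] at h2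
  have e : ContinuousLinearMap.toSpanSingleton ℝ (Gg (s + d)) d = Gg (s + d) * d := by
    simp [mul_comm]
  rw [e] at h2
  exact h2.le

/-- The remainder of a Newton differentiable function under superposition is small in `L²`. -/
theorem tendsto_norm_remainder {Gg : ℝ → ℝ}
    (hN : IsNewtonDifferentiable g (fun s => ContinuousLinearMap.toSpanSingleton ℝ (Gg s)))
    {s : ℝ → ℝ} {d : ℕ → ℝ → ℝ} {t : ℕ → ℝ} {ρ : ℕ → L2 a b} {C D : ℝ} (hC : 0 ≤ C)
    (ht0 : ∀ n, 0 < t n) (ht : Tendsto t atTop (𝓝 0))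
    (hd : ∀ n, ∀ᵐ x ∂(dom a b), |d n x| ≤ D * t n)
    (hρ : ∀ n, ∀ᵐ x ∂(dom a b),
      ρ n x = g (s x + d n x) - g (s x) - Gg (s x + d n x) * d n x)
    (hρb : ∀ n, ∀ᵐ x ∂(dom a b), |ρ n x| ≤ C * |d n x|) :
    Tendsto (fun n => ‖ρ n‖ / t n) atTop (𝓝 0) := by
  have hint : Tendsto (fun n => ∫ x, (ρ n x / t n) ^ 2 ∂(dom a b)) atTop
      (𝓝 (∫ _, 0 ∂(dom a b))) := by
    -- The normalized remainders `ρ n / t n` are bounded by `C D`, and on an interval of finite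
    -- length constants are integrable.
    refine tendsto_integral_of_dominated_convergence (fun _ => (C * D) ^ 2)
      (fun n => (((Lp.aestronglyMeasurable (ρ n)).aemeasurable.div_const _).pow_const
        2).aestronglyMeasurable)
      (integrable_const _) (fun n => ?_) ?_
    · filter_upwards [hd n, hρb n] with x h1 h2
      rw [Real.norm_eq_abs, abs_pow, abs_div, abs_of_pos (ht0 n)]
      refine pow_le_pow_left₀ (div_nonneg (abs_nonneg _) (ht0 n).le) ?_ 2
      rw [div_le_iff₀ (ht0 n), mul_assoc]
      exact h2.trans (mul_le_mul_of_nonneg_left h1 hC)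
    · filter_upwards [ae_all_iff.2 hd, ae_all_iff.2 hρ] with x h1 h2
      have hD : 0 ≤ D := by
        by_contra! hneg
        have := mul_neg_of_neg_of_pos hneg (ht0 0)
        linarith [h1 0, abs_nonneg (d 0 x)]
      have hlim : Tendsto (fun n => ρ n x / t n) atTop (𝓝 0) := by
        rw [Metric.tendsto_atTop]
        intro ε hε
        -- Dividing by `D + 1` admits `D = 0` and leaves room for a strict inequality.
        obtain ⟨δ, hδ, hb⟩ := hN.exists_abs_le (s x) (ε := ε / (D + 1)) (by positivity)
        have hsm : ∀ᶠ n in atTop, D * t n < δ := by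
          have := ht.const_mul D
          rw [mul_zero] at this
          exact this.eventually (gt_mem_nhds hδ)
        obtain ⟨n0, hn0⟩ := eventually_atTop.1 hsm
        refine ⟨n0, fun n hn => ?_⟩
        have h3 := hb (d n x) ((h1 n).trans_lt (hn0 n hn))
        rw [← h2 n] at h3
        rw [Real.dist_eq, sub_zero, abs_div, abs_of_pos (ht0 n), div_lt_iff₀ (ht0 n)]
        calc |ρ n x| ≤ ε / (D + 1) * |d n x| := h3
          _ ≤ ε / (D + 1) * (D * t n) := mul_le_mul_of_nonneg_left (h1 n) (by positivity)
          _ = ε * t n * (D / (D + 1)) := by ring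
          _ < ε * t n * 1 := by
              refine mul_lt_mul_of_pos_left ?_ (mul_pos hε (ht0 n))
              rw [div_lt_one (by linarith)]
              linarith
          _ = ε * t n := mul_one _
      simpa using hlim.pow 2
  rw [integral_zero] at hint
  have e : ∀ n, ‖ρ n‖ / t n = √(∫ x, (ρ n x / t n) ^ 2 ∂(dom a b)) := by
    intro n
    have : ∫ x, (ρ n x / t n) ^ 2 ∂(dom a b) = (‖ρ n‖ / t n) ^ 2 := by
      simp only [div_pow]
      rw [integral_div, L2.norm_sq_eq]
    rw [this, Real.sqrt_sq (div_nonneg (norm_nonneg _) (ht0 n).le)]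
  simp only [e]
  simpa using hint.sqrt

section

variable {Gg : ℝ → ℝ} {u : H10 a b} {T : H1 a b}

/-- The coefficient of the linearized equation is bounded. -/
theorem memLp_coeff (hab : a < b) (hk : 0 < k) (hψ : MemLp ψ ∞ (dom a b))
    (hψ0 : 0 ≤ᵐ[dom a b] ψ) (hg : LocallyLipschitz g) (hgm : Antitone g) (hGm : Measurable Gg)
    (hGc : ∀ s, Gg s ∈ clarkeDifferential g s) (h : IsState k ψ g u T) :
    MemLp (fun x => Gg (ψ x * H1.fn T x - H10.fn u x)) ∞ (dom a b) := by
  refine memLp_top_of_bound (hGm.comp_aemeasurable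
    (memLp_two_state hψ _ _).1.aemeasurable).aestronglyMeasurable
    -- The enlargement by `1` supplies the strict inequality required by the Clarke bound.
    (lipOn g (-(boundM a b k ψ g ‖u‖ + 1)) (boundM a b k ψ g ‖u‖ + 1)) ?_
  filter_upwards [h.ae_abs_le_boundM hab hk hψ hψ0 hg hgm (norm_nonneg u) le_rfl le_rfl] with x hx
  exact abs_le_lipOn_of_mem_clarkeDifferential hg hgm (hGc _) (by linarith)

theorem isLinearizedState_iff (hψ : MemLp ψ ∞ (dom a b))
    (hc : MemLp (fun x => Gg (ψ x * H1.fn T x - H10.fn u x)) ∞ (dom a b)) {h : H10 a b}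
    {ξ : H1 a b} : IsLinearizedState k ψ Gg u T h ξ ↔
      IsVarSol k (L2.mul hc (L2.mul hψ (H1.fn ξ)) - L2.mul hc (H10.fn h)) ξ := by
  refine solvesNeumann_iff ?_
  filter_upwards [linear_coeFn hψ hc (H1.fn ξ) (H10.fn h)] with x hx
  rw [hx]
  ring

end

/-! ### Estimates and Newton differentiability of the weighted solution operator -/

section

variable (hab : a < b) {φ : ℝ → ℝ} (hφ : ContDiff ℝ 2 φ) (ha : φ a = 0) (hb : φ b = 0)

/-- Lipschitz estimate for the weighted solution operator in `H₀¹(Ω)`. -/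
theorem norm_toH10_sub_le (hk : 0 < k) (hψ : MemLp ψ ∞ (dom a b))
    (hψ0 : 0 ≤ᵐ[dom a b] ψ) (hg : LocallyLipschitz g) (hgm : Antitone g) (hR : 0 ≤ R)
    {u u' : H10 a b} (hu : ‖u‖ ≤ R) (hu' : ‖u'‖ ≤ R) {T T' : H1 a b} (h : IsState k ψ g u T)
    (h' : IsState k ψ g u' T') {f f' : L2 a b} (hf : IsVarSol k f T) (hf' : IsVarSol k f' T') :
    ‖Y2.toH10 (weighted hab hφ ha hb hf) - Y2.toH10 (weighted hab hφ ha hb hf')‖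
      ≤ lipOn g (-boundM a b k ψ g R) (boundM a b k ψ g R) * factor a b k φ * ‖u - u'‖ := by
  obtain ⟨e1, e2⟩ := h.sub_le hab hk hψ hψ0 hg hgm hR hu hu' h'
  rw [← map_sub, weighted_sub]
  refine (norm_toH10_weighted_le hab hφ ha hb _ e1 e2).trans (le_of_eq ?_)
  rw [factor]
  ring

/-- Lipschitz estimate for the weighted solution operator in `Y₂`. -/
theorem exists_norm_sub_le (hk : 0 < k) (hψ : MemLp ψ ∞ (dom a b))
    (hψ0 : 0 ≤ᵐ[dom a b] ψ) (hg : LocallyLipschitz g) (hgm : Antitone g) (hR : 0 ≤ R) :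
    ∃ C > 0, ∀ (u u' : H10 a b), ‖u‖ ≤ R → ‖u'‖ ≤ R → ∀ (T T' : H1 a b) (f f' : L2 a b),
      IsState k ψ g u T → IsState k ψ g u' T' →
      f =ᵐ[dom a b] (fun x => g (ψ x * H1.fn T x - H10.fn u x)) →
      f' =ᵐ[dom a b] (fun x => g (ψ x * H1.fn T' x - H10.fn u' x)) →
      ∀ (hf : IsVarSol k f T) (hf' : IsVarSol k f' T'),
      ‖weighted hab hφ ha hb hf - weighted hab hφ ha hb hf'‖ ≤ C * ‖u - u'‖ := by
  set L := lipOn g (-boundM a b k ψ g R) (boundM a b k ψ g R) with hL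
  have hL0 : 0 ≤ L := lipOn_nonneg _ _ _
  set p := (b - a) / Real.pi with hp
  have hp0 : 0 ≤ p := div_nonneg (by linarith) Real.pi_pos.le
  have s0 := supNorm_nonneg a b φ
  have s1 := supNorm_nonneg a b (deriv φ)
  have s2 := supNorm_nonneg a b (deriv (deriv φ))
  have s3 := supNorm_nonneg a b ψ
  set Cφ := supNorm a b φ + 2 * supNorm a b (deriv φ) + supNorm a b (deriv (deriv φ)) with hCφ
  have hC0 : 0 ≤ Cφ := by positivity
  set C := Cφ * ((1 + k) * (k⁻¹ * (L * p)) + k ^ (-(1 / 2) : ℝ) * (L * p)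
    + L * (supNorm a b ψ * (k⁻¹ * (L * p)) + p)) with hC
  have hCn : 0 ≤ C := by positivity
  -- `C` itself may be zero, whereas a positive constant is required.
  refine ⟨C + 1, by linarith, fun u u' hu hu' T T' f f' h h' hfe hfe' hf hf' => ?_⟩
  obtain ⟨e1, e2⟩ := h.sub_le hab hk hψ hψ0 hg hgm hR hu hu' h'
  rw [weighted_sub]
  refine (norm_weighted_le hab hφ ha hb hk _).trans ?_
  have e3 : ‖f - f'‖ ≤ L * ‖L2.mul hψ (H1.fn (T - T')) - H10.fn (u - u')‖ := by
    refine L2.norm_le_of_ae_le ?_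
    rw [map_sub, H10.fn_sub]
    filter_upwards [hfe, hfe', h.ae_abs_le_boundM hab hk hψ hψ0 hg hgm hR hu hu,
      h'.ae_abs_le_boundM hab hk hψ hψ0 hg hgm hR hu' hu', Lp.coeFn_sub f f',
      Lp.coeFn_sub (H1.fn T) (H1.fn T'), Lp.coeFn_sub (H10.fn u) (H10.fn u'),
      L2.coeFn_mul hψ (H1.fn T - H1.fn T'),
      Lp.coeFn_sub (L2.mul hψ (H1.fn T - H1.fn T')) (H10.fn u - H10.fn u')]
      with x h1 h2 h3 h4 h5 h6 h7 h8 h9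
    rw [h5, h9, Pi.sub_apply, Pi.sub_apply, h8, h6, h7, Pi.sub_apply, Pi.sub_apply, h1, h2]
    refine (abs_sub_le_lipOn hg (abs_le.1 h3) (abs_le.1 h4)).trans (le_of_eq ?_)
    congr 2
    ring
  have e4 : ‖L2.mul hψ (H1.fn (T - T')) - H10.fn (u - u')‖
      ≤ supNorm a b ψ * (k⁻¹ * (L * (p * ‖u - u'‖))) + p * ‖u - u'‖ :=
    (norm_sub_le _ _).trans (add_le_add ((L2.norm_mul_le hψ _).trans
      (mul_le_mul_of_nonneg_left e1 s3)) (H10.norm_fn_le hab _))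
  have e5 := e3.trans (mul_le_mul_of_nonneg_left e4 hL0)
  have e6 := mul_le_mul_of_nonneg_left e1 (by linarith : 0 ≤ 1 + k)
  calc _ ≤ Cφ * ((1 + k) * (k⁻¹ * (L * (p * ‖u - u'‖))) + k ^ (-(1 / 2) : ℝ) * (L * (p * ‖u - u'‖))
        + L * (supNorm a b ψ * (k⁻¹ * (L * (p * ‖u - u'‖))) + p * ‖u - u'‖)) :=
        mul_le_mul_of_nonneg_left (by linarith) hC0
    _ = C * ‖u - u'‖ := by rw [hC]; ring
    _ ≤ (C + 1) * ‖u - u'‖ := mul_le_mul_of_nonneg_right (by linarith) (norm_nonneg _)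

/-- Bound for the weighted solution of the linearized equation in `H₀¹(Ω)`. -/
theorem norm_toH10_linear_le (hk : 0 < k) (hψ : MemLp ψ ∞ (dom a b)) (hψ0 : 0 ≤ᵐ[dom a b] ψ)
    {c : ℝ → ℝ} (hc : MemLp c ∞ (dom a b)) (hc0 : c ≤ᵐ[dom a b] 0) {L : ℝ} (hL0 : 0 ≤ L)
    (hcL : ∀ᵐ x ∂(dom a b), |c x| ≤ L) {h : H10 a b} {ξ : H1 a b}
    (hξ : IsVarSol k (L2.mul hc (L2.mul hψ (H1.fn ξ)) - L2.mul hc (H10.fn h)) ξ) :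
    ‖Y2.toH10 (weighted hab hφ ha hb hξ)‖ ≤ L * factor a b k φ * ‖h‖ := by
  have hm := ae_mul_nonpos_of_linear hψ0 hc0 (linear_coeFn' hψ hc (H1.fn ξ) (H10.fn h))
  have hn : ‖-L2.mul hc (H10.fn h)‖ ≤ L * ((b - a) / Real.pi * ‖h‖) := by
    rw [norm_neg]
    refine (L2.norm_le_of_ae_le (c := L) (w := H10.fn h) ?_).trans
      (mul_le_mul_of_nonneg_left (H10.norm_fn_le hab h) hL0)
    filter_upwards [L2.coeFn_mul hc (H10.fn h), hcL] with x h1 h2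
    rw [h1, abs_mul]
    exact mul_le_mul_of_nonneg_right h2 (abs_nonneg _)
  refine (norm_toH10_weighted_le hab hφ ha hb hξ
    ((hξ.norm_fn_le hk hm).trans (mul_le_mul_of_nonneg_left hn (inv_nonneg.2 hk.le)))
    ((hξ.norm_wd_le hk hm).trans
      (mul_le_mul_of_nonneg_left hn (Real.rpow_nonneg hk.le _)))).trans (le_of_eq ?_)
  rw [factor]
  ring

/-- The remainder of the linearization is controlled by the remainder of the nonlinearity. -/
theorem norm_weighted_remainder_le (hk : 0 < k) (hψ : MemLp ψ ∞ (dom a b))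
    (hψ0 : 0 ≤ᵐ[dom a b] ψ) {c : ℝ → ℝ} (hc : MemLp c ∞ (dom a b)) (hc0 : c ≤ᵐ[dom a b] 0) {L : ℝ}
    (hL0 : 0 ≤ L) (hcL : ∀ᵐ x ∂(dom a b), |c x| ≤ L) {f ρ : L2 a b} {r : H1 a b}
    (hr : IsVarSol k f r) (hf : ∀ᵐ x ∂(dom a b), f x = c x * (ψ x * H1.fn r x) + ρ x) :
    ‖weighted hab hφ ha hb hr‖ ≤ (supNorm a b φ + 2 * supNorm a b (deriv φ)
      + supNorm a b (deriv (deriv φ))) * ((1 + k) * k⁻¹ + k ^ (-(1 / 2) : ℝ)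
      + (L * (supNorm a b ψ * k⁻¹) + 1)) * ‖ρ‖ := by
  have hm := ae_mul_nonpos_of_linear hψ0 hc0 hf
  have e1 := hr.norm_fn_le hk hm
  have e2 := hr.norm_wd_le hk hm
  have e3 : ‖f‖ ≤ L * (supNorm a b ψ * (k⁻¹ * ‖ρ‖)) + ‖ρ‖ := by
    have h1 : f = L2.mul hc (L2.mul hψ (H1.fn r)) + ρ := by
      refine Lp.ext ?_
      filter_upwards [hf, L2.coeFn_mul hc (L2.mul hψ (H1.fn r)), L2.coeFn_mul hψ (H1.fn r),
        Lp.coeFn_add (L2.mul hc (L2.mul hψ (H1.fn r))) ρ] with x h1 h2 h3 h4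
      rw [h1, h4, Pi.add_apply, h2, h3]
    have h2 : ‖L2.mul hc (L2.mul hψ (H1.fn r))‖ ≤ L * ‖L2.mul hψ (H1.fn r)‖ := by
      refine L2.norm_le_of_ae_le ?_
      filter_upwards [L2.coeFn_mul hc (L2.mul hψ (H1.fn r)), hcL] with x h1 h2
      rw [h1, abs_mul]
      exact mul_le_mul_of_nonneg_right h2 (abs_nonneg _)
    rw [h1]
    refine (norm_add_le _ _).trans (add_le_add (h2.trans (mul_le_mul_of_nonneg_left
      ((L2.norm_mul_le hψ _).trans
        (mul_le_mul_of_nonneg_left e1 (supNorm_nonneg _ _ _))) hL0)) le_rfl)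
  have s0 := supNorm_nonneg a b φ
  have s1 := supNorm_nonneg a b (deriv φ)
  have s2 := supNorm_nonneg a b (deriv (deriv φ))
  refine (norm_weighted_le hab hφ ha hb hk hr).trans ?_
  rw [mul_assoc]
  refine mul_le_mul_of_nonneg_left ?_ (by positivity)
  have e6 := mul_le_mul_of_nonneg_left e1 (by linarith : 0 ≤ 1 + k)
  linarith

/-- Newton differentiability of the weighted solution operator. -/
theorem isNewtonDifferentiable_weighted (hk : 0 < k) (hψ : MemLp ψ ∞ (dom a b))
    (hψ0 : 0 ≤ᵐ[dom a b] ψ) (hg : LocallyLipschitz g) (hgm : Antitone g) {Gg : ℝ → ℝ}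
    (hGg : IsNewtonDifferentiable g (fun s => ContinuousLinearMap.toSpanSingleton ℝ (Gg s)))
    (hGc : ∀ s, Gg s ∈ clarkeDifferential g s)
    {T : H10 a b → H1 a b} (hT : ∀ u, IsState k ψ g u (T u)) {f : H10 a b → L2 a b}
    (hfe : ∀ u, f u =ᵐ[dom a b] fun x => g (ψ x * H1.fn (T u) x - H10.fn u x))
    (hf : ∀ u, IsVarSol k (f u) (T u))
    (hc : ∀ u, MemLp (fun x => Gg (ψ x * H1.fn (T u) x - H10.fn u x)) ∞ (dom a b))
    {G : H10 a b → H10 a b →L[ℝ] Y2 a b}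
    (hG : ∀ u h, ∃ (ξ : H1 a b) (hξ : IsVarSol k
      (L2.mul (hc u) (L2.mul hψ (H1.fn ξ)) - L2.mul (hc u) (H10.fn h)) ξ),
      G u h = weighted hab hφ ha hb hξ) :
    IsNewtonDifferentiable (fun u => weighted hab hφ ha hb (hf u)) G := by
  intro u
  -- Sequences suffice, and they are what dominated convergence needs.
  refine tendsto_of_seq_tendsto fun h₀ hh₀ => ?_
  rw [tendsto_nhdsWithin_iff] at hh₀
  obtain ⟨hlim, hne⟩ := hh₀
  set R := ‖u‖ + 1 with hR
  have hR0 : 0 ≤ R := by positivity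
  have hu : ‖u‖ ≤ R := by linarith
  have hnlim : Tendsto (fun n => ‖h₀ n‖) atTop (𝓝 0) := by simpa using hlim.norm
  -- After a shift of the index every increment is nonzero and shorter than `1`, so all points stay
  -- in the ball of radius `‖u‖ + 1`.
  obtain ⟨n0, hn0⟩ := eventually_atTop.1 (hne.and (hnlim.eventually (gt_mem_nhds one_pos)))
  rw [← tendsto_add_atTop_iff_nat n0]
  set h : ℕ → H10 a b := fun n => h₀ (n + n0) with hh
  have hpos : ∀ n, 0 < ‖h n‖ := fun n => norm_pos_iff.2 (hn0 (n + n0) (by omega)).1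
  have hle : ∀ n, ‖h n‖ < 1 := fun n => (hn0 (n + n0) (by omega)).2
  have hnh : Tendsto (fun n => ‖h n‖) atTop (𝓝 0) :=
    (tendsto_add_atTop_iff_nat n0).2 hnlim
  have huh : ∀ n, ‖u + h n‖ ≤ R := fun n =>
    (norm_add_le _ _).trans (by linarith [hle n])
  set M := boundM a b k ψ g R with hM
  set L := lipOn g (-(M + 1)) (M + 1) with hL
  have hL0 : 0 ≤ L := lipOn_nonneg _ _ _
  have hLM : lipOn g (-M) M ≤ L := lipOn_mono hg (by linarith) (by linarith)
  have hcL : ∀ n, ∀ᵐ x ∂(dom a b),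
      |Gg (ψ x * H1.fn (T (u + h n)) x - H10.fn (u + h n) x)| ≤ L := fun n => by
    filter_upwards [(hT (u + h n)).ae_abs_le_boundM hab hk hψ hψ0 hg hgm hR0 (huh n) (huh n)]
      with x hx
    exact abs_le_lipOn_of_mem_clarkeDifferential hg hgm (hGc _) (by linarith)
  choose ξ hξ hGξ using fun n => hG (u + h n) (h n)
  -- the increment of the argument of the nonlinearity
  set d : ℕ → ℝ → ℝ := fun n x => ψ x * H1.fn (T (u + h n) - T u) x - H10.fn (h n) x with hd
  have hsd : ∀ n, ∀ᵐ x ∂(dom a b), ψ x * H1.fn (T (u + h n)) x - H10.fn (u + h n) x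
      = (ψ x * H1.fn (T u) x - H10.fn u x) + d n x := fun n => by
    simp only [hd]
    rw [map_sub, H10.fn_add]
    filter_upwards [Lp.coeFn_sub (H1.fn (T (u + h n))) (H1.fn (T u)),
      Lp.coeFn_add (H10.fn u) (H10.fn (h n))] with x h1 h2
    rw [h1, h2, Pi.sub_apply, Pi.add_apply]
    ring
  set r : ℕ → H1 a b := fun n => T (u + h n) - T u - ξ n with hr
  set fr : ℕ → L2 a b := fun n => f (u + h n) - f u - (L2.mul (hc (u + h n))
    (L2.mul hψ (H1.fn (ξ n))) - L2.mul (hc (u + h n)) (H10.fn (h n))) with hfr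
  have hrs : ∀ n, IsVarSol k (fr n) (r n) := fun n => ((hf (u + h n)).sub (hf u)).sub (hξ n)
  -- This source makes `r n` solve the linearized equation at `u + h n`. The terms containing `ξ n`
  -- cancel, and what remains is the Newton remainder of `g` with increment `d n`.
  set ρ : ℕ → L2 a b := fun n => fr n - L2.mul (hc (u + h n)) (L2.mul hψ (H1.fn (r n))) with hρ
  have hfre : ∀ n, ∀ᵐ x ∂(dom a b), fr n x
      = Gg (ψ x * H1.fn (T (u + h n)) x - H10.fn (u + h n) x) * (ψ x * H1.fn (r n) x) + ρ n x :=
    fun n => by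
      filter_upwards [L2.coeFn_mul (hc (u + h n)) (L2.mul hψ (H1.fn (r n))),
        L2.coeFn_mul hψ (H1.fn (r n)),
        Lp.coeFn_sub (fr n) (L2.mul (hc (u + h n)) (L2.mul hψ (H1.fn (r n))))] with x h1 h2 h3
      simp only [hρ]
      rw [h3, Pi.sub_apply, h1, h2]
      ring
  have hρe : ∀ n, ∀ᵐ x ∂(dom a b), ρ n x = g ((ψ x * H1.fn (T u) x - H10.fn u x) + d n x)
      - g (ψ x * H1.fn (T u) x - H10.fn u x)
      - Gg ((ψ x * H1.fn (T u) x - H10.fn u x) + d n x) * d n x := fun n => by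
    have e1 : H1.fn (r n) = H1.fn (T (u + h n) - T u) - H1.fn (ξ n) := map_sub _ _ _
    filter_upwards [hfre n, hsd n, hfe (u + h n), hfe u,
      linear_coeFn hψ (hc (u + h n)) (H1.fn (ξ n)) (H10.fn (h n)),
      Lp.coeFn_sub (f (u + h n)) (f u), Lp.coeFn_sub (f (u + h n) - f u) (L2.mul (hc (u + h n))
        (L2.mul hψ (H1.fn (ξ n))) - L2.mul (hc (u + h n)) (H10.fn (h n))),
      Lp.coeFn_sub (H1.fn (T (u + h n) - T u)) (H1.fn (ξ n))] with x h1 h2 h3 h4 h5 h6 h7 h8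
    rw [e1, h8, Pi.sub_apply] at h1
    simp only [hfr] at h1
    rw [h7, Pi.sub_apply, h6, Pi.sub_apply, h5, h3, h4, h2] at h1
    have h9 : d n x = ψ x * H1.fn (T (u + h n) - T u) x - H10.fn (h n) x := rfl
    linear_combination -h1 - Gg ((ψ x * H1.fn (T u) x - H10.fn u x) + d n x) * h9
  have hρb : ∀ n, ∀ᵐ x ∂(dom a b), |ρ n x| ≤ (2 * L) * |d n x| := fun n => by
    filter_upwards [hρe n, hcL n, hsd n,
      (hT (u + h n)).ae_abs_le_boundM hab hk hψ hψ0 hg hgm hR0 (huh n) (huh n),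
      (hT u).ae_abs_le_boundM hab hk hψ hψ0 hg hgm hR0 hu hu] with x h1 h2 h3 h4 h5
    rw [h3] at h2 h4
    have h6 := abs_sub_le_lipOn hg (abs_le.1 h4) (abs_le.1 h5)
    rw [add_sub_cancel_left] at h6
    have h7 := mul_le_mul_of_nonneg_right hLM (abs_nonneg (d n x))
    have h8 := mul_le_mul_of_nonneg_right h2 (abs_nonneg (d n x))
    rw [h1]
    refine (abs_sub _ _).trans ?_
    rw [abs_mul]
    linarith
  set p := (b - a) / Real.pi with hp
  -- The first summand combines the `L^∞` embedding of `H¹` with the stability of the state; the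
  -- second is the pointwise bound for `h n`.
  set D := supNorm a b ψ * ((b - a) ^ (-(1 / 2) : ℝ) * (k⁻¹ * (lipOn g (-M) M * p))
    + (b - a) ^ (1 / 2 : ℝ) * (k ^ (-(1 / 2) : ℝ) * (lipOn g (-M) M * p)))
    + (b - a) ^ (1 / 2 : ℝ) / 2 with hD
  have hdb : ∀ n, ∀ᵐ x ∂(dom a b), |d n x| ≤ D * ‖h n‖ := fun n => by
    obtain ⟨e1, e2⟩ := (hT (u + h n)).sub_le hab hk hψ hψ0 hg hgm hR0 (huh n) hu (hT u)
    rw [add_sub_cancel_left] at e1 e2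
    filter_upwards [H1.ae_abs_le hab (T (u + h n) - T u), H10.ae_abs_le hab (le_refl ‖h n‖),
      ae_abs_le_supNorm hψ] with x h1 h2 h3
    have hpos' : 0 ≤ b - a := by linarith
    have e3 := mul_le_mul_of_nonneg_left e1 (Real.rpow_nonneg hpos' (-(1 / 2)))
    have e4 := mul_le_mul_of_nonneg_left e2 (Real.rpow_nonneg hpos' (1 / 2))
    have e5 := mul_le_mul h3 (h1.trans (add_le_add e3 e4)) (abs_nonneg _) (supNorm_nonneg _ _ _)
    refine (abs_sub _ _).trans ?_
    rw [abs_mul]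
    refine (add_le_add e5 h2).trans (le_of_eq ?_)
    rw [boundN, hD]
    ring
  have hfin := tendsto_norm_remainder (t := fun n => ‖h n‖) hGg (mul_nonneg two_pos.le hL0) hpos hnh
    hdb hρe hρb
  set K := (supNorm a b φ + 2 * supNorm a b (deriv φ) + supNorm a b (deriv (deriv φ)))
    * ((1 + k) * k⁻¹ + k ^ (-(1 / 2) : ℝ) + (L * (supNorm a b ψ * k⁻¹) + 1)) with hK
  have hfin' := hfin.const_mul K
  rw [mul_zero] at hfin'
  refine squeeze_zero (fun n => div_nonneg (norm_nonneg _) (norm_nonneg _)) (fun n => ?_) hfin'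
  have hc0 : (fun x => Gg (ψ x * H1.fn (T (u + h n)) x - H10.fn (u + h n) x)) ≤ᵐ[dom a b] 0 :=
    Eventually.of_forall fun x => nonpos_of_mem_clarkeDifferential hg hgm (hGc _)
  have hb' := norm_weighted_remainder_le hab hφ ha hb hk hψ hψ0 (hc (u + h n)) hc0 hL0 (hcL n)
    (hrs n) (hfre n)
  rw [← mul_div_assoc]
  refine div_le_div_of_nonneg_right ?_ (norm_nonneg _)
  show ‖weighted hab hφ ha hb (hf (u + h n)) - weighted hab hφ ha hb (hf u) - G (u + h n) (h n)‖ ≤ _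
  rw [hGξ, weighted_sub, weighted_sub]
  exact hb'

end

end NeumannObstacle

end

/-! ### The main theorem -/

open MeasureTheory Filter Topology NeumannObstacle
theorem mainTheorem5 (a b : ℝ) (hab : a < b)
    (φ : ℝ → ℝ) (hφ : ContDiffOn ℝ 2 φ (Set.Icc a b)) (hφa : φ a = 0) (hφb : φ b = 0)
    (k : ℝ) (hk : 0 < k)
    (ψ : ℝ → ℝ) (hψ : MemLp ψ ⊤ (dom a b)) (hψ0 : 0 ≤ᵐ[dom a b] ψ)
    (g : ℝ → ℝ) (hg : LocallyLipschitz g) (hgm : Antitone g)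
    (Gg : ℝ → ℝ) (hGgm : Measurable Gg)
    (hGg : IsNewtonDifferentiable g (fun s => ContinuousLinearMap.toSpanSingleton ℝ (Gg s)))
    (hGgc : ∀ s, Gg s ∈ clarkeDifferential g s) :
    -- unique solvability
    (∀ u : H10 a b, ∃! T : H1 a b, IsState k ψ g u T) ∧
    -- the obstacle map `Φ(u) = φ T`
    ∃ Φ : H10 a b → Y2 a b,
      (∀ u T, IsState k ψ g u T → Y2.IsFn (Φ u) (fun x => φ x * H1.fn T x)) ∧
      -- local Lipschitz estimate in `H₀¹`
      (∀ R > 0, ∀ u₁ ∈ Metric.closedBall (0 : H10 a b) R,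
        ∀ u₂ ∈ Metric.closedBall (0 : H10 a b) R,
        ‖Y2.toH10 (Φ u₁) - Y2.toH10 (Φ u₂)‖ ≤
          lipOn g (-boundM a b k ψ g R) (boundM a b k ψ g R) * factor a b k φ * ‖u₁ - u₂‖) ∧
      -- local Lipschitz estimate in `Y₂`
      (∀ R > 0, ∃ C > 0, ∀ u₁ ∈ Metric.closedBall (0 : H10 a b) R,
        ∀ u₂ ∈ Metric.closedBall (0 : H10 a b) R, ‖Φ u₁ - Φ u₂‖ ≤ C * ‖u₁ - u₂‖) ∧
      -- Newton differentiability with derivative `G_Φ(u) h = φ ξ_h`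
      (∀ u T, IsState k ψ g u T → ∀ h, ∃! ξ : H1 a b, IsLinearizedState k ψ Gg u T h ξ) ∧
      ∃ GΦ : H10 a b → H10 a b →L[ℝ] Y2 a b,
        (∀ u T h ξ, IsState k ψ g u T → IsLinearizedState k ψ Gg u T h ξ →
          Y2.IsFn (GΦ u h) (fun x => φ x * H1.fn ξ x)) ∧
        IsNewtonDifferentiable Φ GΦ ∧
        ∀ R > 0, ∃ L, Tendsto (fun t => lipOn g (-t) t) (𝓝[>] (boundM a b k ψ g R)) (𝓝 L) ∧
          ∀ u ∈ Metric.closedBall (0 : H10 a b) R,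
            ‖Y2.toH10.comp (GΦ u)‖ ≤ L * factor a b k φ := by
  -- Here `φ'` is a global `C²` extension of `φ`, not its derivative.
  obtain ⟨φ', hφ', hφe⟩ := exists_contDiff_eqOn hab hφ
  have ha : φ' a = 0 := (hφe (Set.left_mem_Icc.2 hab.le)).trans hφa
  have hb : φ' b = 0 := (hφe (Set.right_mem_Icc.2 hab.le)).trans hφb
  have hfn : ∀ {y : Y2 a b} {v : ℝ → ℝ}, Y2.IsFn y (fun x => φ' x * v x) →
      Y2.IsFn y (fun x => φ x * v x) := fun h => by
    refine h.trans ?_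
    filter_upwards [ae_restrict_mem measurableSet_Ioo] with x hx
    rw [hφe (Set.Ioo_subset_Icc_self hx)]
  simp only [← factor_congr k hφe, mem_closedBall_zero_iff]
  choose T hT using fun u : H10 a b => exists_isState hab hk hψ hψ0 hg hgm u
  have hTu : ∀ {u T'}, IsState k ψ g u T' → T' = T u := fun h =>
    h.unique hk hψ0 hgm (hT _)
  choose f hfe hf using fun u => (hT u).exists_isVarSol
  have hc := fun u => memLp_coeff hab hk hψ hψ0 hg hgm hGgm hGgc (hT u)
  have hc0 : ∀ u, (fun x => Gg (ψ x * H1.fn (T u) x - H10.fn u x)) ≤ᵐ[dom a b] 0 := fun u =>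
    Eventually.of_forall fun x => nonpos_of_mem_clarkeDifferential hg hgm (hGgc _)
  choose G hG using fun u => exists_weighted_linear hab hφ' ha hb hk hψ hψ0 (hc u) (hc0 u)
  refine ⟨fun u => ⟨T u, hT u, fun T' h => hTu h⟩,
    fun u => weighted hab hφ' ha hb (hf u), ?_, ?_, ?_, ?_, G, ?_, ?_, ?_⟩
  · intro u T' h
    rw [hTu h]
    exact hfn (isFn_weighted hab hφ' ha hb (hf u))
  · intro R hR u hu u' hu'
    exact norm_toH10_sub_le hab hφ' ha hb hk hψ hψ0 hg hgm hR.le hu hu' (hT u) (hT u') (hf u) (hf u')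
  · intro R hR
    obtain ⟨C, hC, h⟩ := exists_norm_sub_le hab hφ' ha hb hk hψ hψ0 hg hgm hR.le
    exact ⟨C, hC, fun u hu u' hu' => h u u' hu hu' _ _ _ _ (hT u) (hT u') (hfe u) (hfe u') _ _⟩
  · intro u T' h η
    rw [hTu h]
    simp only [isLinearizedState_iff hψ (hc u)]
    obtain ⟨ξ, hξ, -⟩ := hG u η
    exact ⟨ξ, hξ, fun ξ' hξ' => unique_isVarSol_linear hk hψ hψ0 (hc u) (hc0 u) hξ' hξ⟩
  · intro u T' η ξ' h hξ'
    rw [hTu h, isLinearizedState_iff hψ (hc u)] at hξ'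
    obtain ⟨ξ, hξ, e⟩ := hG u η
    rw [e, unique_isVarSol_linear hk hψ hψ0 (hc u) (hc0 u) hξ' hξ]
    exact hfn (isFn_weighted hab hφ' ha hb hξ)
  · exact isNewtonDifferentiable_weighted hab hφ' ha hb hk hψ hψ0 hg hgm hGg hGgc hT hfe hf hc hG
  · intro R hR
    obtain ⟨L, hL⟩ := exists_tendsto_lipOn hg (boundM a b k ψ g R)
    have hL0 : 0 ≤ L := ge_of_tendsto' hL fun t => lipOn_nonneg _ _ _
    refine ⟨L, hL, fun u hu => ContinuousLinearMap.opNorm_le_bound _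
      (mul_nonneg hL0 (factor_nonneg hab hk _)) fun η => ?_⟩
    obtain ⟨ξ, hξ, e⟩ := hG u η
    rw [ContinuousLinearMap.comp_apply, e]
    refine norm_toH10_linear_le hab hφ' ha hb hk hψ hψ0 (hc u) (hc0 u) hL0 ?_ hξ
    filter_upwards [(hT u).ae_abs_le_boundM hab hk hψ hψ0 hg hgm hR.le hu hu] with x hx
    -- The coefficient is bounded by `lipOn g (-t) t` for every `t > M_R`; the limit is taken
    -- pointwise, before the energy estimate.
    refine ge_of_tendsto hL ?_
    filter_upwards [self_mem_nhdsWithin] with t ht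
    exact abs_le_lipOn_of_mem_clarkeDifferential hg hgm (hGgc _) (lt_of_le_of_lt hx ht)
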